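/- Let $W(x)=W(x,0)$, $x\in\mathbb R$, be a (strictly) stationary real Gaussian process whose sample paths are a.s. continuously differentiable, let $W_x$ denote the derivative of $W$ in $x$, and assume that $W$ is non-degenerate, $\lambda_{20}:=\operatorname{Var}(W_x(0))>0$. The wave centres in $[0,1]$ are the points $x\in[0,1]$ with $W(x)=0$ and $W_x(x)<0$. Then the expected number of wave centres in $[0,1]$ is positive and finite, and the Palm distribution function of the slope at wave centres, $$F^{\mathrm{space}}_{W_x}(w)=\frac{\mathbb E[\#\{x\in[0,1]:W(x)=0,\ W_x(x)<0,\ W_x(x)\le w\}]}{\mathbb E[\#\{x\in[0,1]:W(x)=0,\ W_x(x)<0\}]},$$ satisfies the following for all $w\in\mathbb R$. (1) The vector $(W_x(0),W(0))$ and the variable $W(0)$ have continuous densities $f_{W_x(0),W(0)}$ and $f_{W(0)}$, $f_{W(0)}(0)>0$, and with $x^-=\max(-x,0)$, $$F^{\mathrm{space}}_{W_x}(w)=\frac{\mathbb E[W_x(0)^-\mathbf 1_{\{W_x(0)\le w\}}\mid W(0)=0]\,f_{W(0)}(0)}{\mathbb E[W_x(0)^-\mid W(0)=0]\,f_{W(0)}(0)},$$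 where $\mathbb E[g(W_x(0))\mid W(0)=0]=\int g(z)\,f_{W_x(0),W(0)}(z,0)/f_{W(0)}(0)\,dz$, and $\mathbb E[W_x(0)^-\mid W(0)=0]$ is finite and positive. (2) $F^{\mathrm{space}}_{W_x}(w)=\mathbb P(\sqrt{\lambda_{20}}\,R^-\le w)$, where $R^-$ is a random variable with the probability density $f_{R^-}(r)=-r e^{-r^2/2}$ for $r<0$ and $0$ for $r\ge 0$. (3) If moreover $W$ has a directional spectral density $S\ge 0$, integrable on $(0,\infty)\times[0,2\pi]$, with measurable dispersion law $\omega\mapsto\kappa(\omega)$ (for example $\kappa=\omega^2/g$), that is, $\operatorname{Cov}(W(x),W(x+\xi))=\int_0^\infty\!\int_0^{2\pi}\cos(\kappa(\omega)\xi\cos\theta)\,S(\omega,\theta)\,d\theta\,d\omega$ for all $x,\xi$, then the spectral moment $\int_0^\infty\!\int_0^{2\pi}(\kappa(\omega)\cos\theta)^2S(\omega,\theta)\,d\theta\,d\omega$ is finite and equals $\lambda_{20}$. -/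

import Mathlib

open MeasureTheory ProbabilityTheory Set
open scoped ENNReal

/-- (Strict) stationarity of a real process indexed by the line: the finite-dimensional
distributions are invariant under translations. -/
def IsStationaryProcess {Ω : Type*} [MeasurableSpace Ω] (X : ℝ → Ω → ℝ) (P : Measure Ω) : Prop :=
  ∀ (h : ℝ) (n : ℕ) (t : Fin n → ℝ),
    P.map (fun ω i => X (t i + h) ω) = P.map (fun ω i => X (t i) ω)

/-- The slope `W_x(x)`: the pathwise derivative of the process in the space variable. -/
noncomputable def pathSlope {Ω : Type*} (W : ℝ → Ω → ℝ) (x : ℝ) (ω : Ω) : ℝ :=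
  deriv (fun y => W y ω) x

/-- The wave centres in `[0, 1]` of the realization `ω`: zeros of `W` with negative slope. -/
def waveCentres {Ω : Type*} (W : ℝ → Ω → ℝ) (ω : Ω) : Set ℝ :=
  {x | x ∈ Icc (0 : ℝ) 1 ∧ W x ω = 0 ∧ pathSlope W x ω < 0}

/-- `E[#{x ∈ [0,1] : x is a wave centre}]`. -/
noncomputable def expectedCentres {Ω : Type*} [MeasurableSpace Ω] (P : Measure Ω)
    (W : ℝ → Ω → ℝ) : ℝ≥0∞ :=
  ∫⁻ ω, ((waveCentres W ω).encard : ℝ≥0∞) ∂P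

/-- `E[#{x ∈ [0,1] : x is a wave centre with W_x(x) ≤ w}]`. -/
noncomputable def expectedCentresSlopeLE {Ω : Type*} [MeasurableSpace Ω] (P : Measure Ω)
    (W : ℝ → Ω → ℝ) (w : ℝ) : ℝ≥0∞ :=
  ∫⁻ ω, (({x | x ∈ waveCentres W ω ∧ pathSlope W x ω ≤ w} : Set ℝ).encard : ℝ≥0∞) ∂P

/-- The Palm distribution function of the slope at wave centres: the ratio of the two intensities.
It is meaningful when the denominator is finite and nonzero. -/
noncomputable def palmSlopeCDF {Ω : Type*} [MeasurableSpace Ω] (P : Measure Ω)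
    (W : ℝ → Ω → ℝ) (w : ℝ) : ℝ :=
  (expectedCentresSlopeLE P W w / expectedCentres P W).toReal

/-- `f` is a continuous Lebesgue density of the measure `μ`. Such an `f` is unique when it exists,
so that its values at individual points are determined by `μ`. -/
structure IsContinuousDensity {E : Type*} [MeasureSpace E] [TopologicalSpace E]
    (f : E → ℝ) (μ : Measure E) : Prop where
  continuous : Continuous f
  nonneg : ∀ x, 0 ≤ f x
  eq_withDensity : μ = (volume : Measure E).withDensity (fun x => ENNReal.ofReal (f x))

/-- The conditional expectation `E[g(Y) | Z = u]` computed from the density `fYZ` of `(Y, Z)` and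
the density `fZ` of `Z`: the integral of `g` against the conditional density of `Y` given `Z = u`. -/
noncomputable def condExpGivenValue (fYZ : ℝ × ℝ → ℝ) (fZ : ℝ → ℝ) (g : ℝ → ℝ) (u : ℝ) : ℝ :=
  ∫ y, g y * (fYZ (y, u) / fZ u)

/-- The negative part `x⁻ = max (-x) 0`, nonnegative. -/
def negativePart (x : ℝ) : ℝ := max (-x) 0

/-- The negative Rayleigh law, with density `-r e^{-r²/2}` on `r < 0`. -/
noncomputable def negRayleigh : Measure ℝ :=
  volume.withDensity
    (fun r => ENNReal.ofReal (if r < 0 then -r * Real.exp (-r ^ 2 / 2) else 0))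

/-- The frequency-direction domain `ω > 0`, `θ ∈ [0, 2π]`. -/
def spectralDomain : Set (ℝ × ℝ) := Ioi (0 : ℝ) ×ˢ Icc (0 : ℝ) (2 * Real.pi)

/-- The spectral moment `λ_{ij} = ∫∫ (κ(ω) cos θ)^i ω^j S(ω, θ) dθ dω`; here `κ(ω)` is the wave
number given by the dispersion law. -/
noncomputable def spectralMoment (S : ℝ × ℝ → ℝ) (κ : ℝ → ℝ) (i j : ℕ) : ℝ :=
  ∫ p in spectralDomain, (κ p.1 * Real.cos p.2) ^ i * p.1 ^ j * S p

/-- `S(ω, θ)` is a directional spectral density, with dispersion law `κ(ω)`, of the process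
`W(x) = W(x, 0)`: its covariance at lag `ξ` is `∫∫ cos(κ(ω) ξ cos θ) S(ω, θ) dθ dω`. -/
structure IsDirectionalSpectrum {Ω : Type*} [MeasurableSpace Ω] (P : Measure Ω)
    (W : ℝ → Ω → ℝ) (S : ℝ × ℝ → ℝ) (κ : ℝ → ℝ) : Prop where
  measurable_dispersion : Measurable κ
  nonneg : ∀ p ∈ spectralDomain, 0 ≤ S p
  integrable : IntegrableOn S spectralDomain
  covariance_eq : ∀ x ξ : ℝ, covariance (W x) (W (x + ξ)) P =
    ∫ p in spectralDomain, Real.cos (κ p.1 * ξ * Real.cos p.2) * S p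

open scoped NNReal

/-! Everything follows from an exact Rice formula with marks: for a centred smooth stationary
Gaussian process `U` with covariance `ρ`, the mean number of points of `I` where `U = u` with slope
in `B ⊆ (-∞, 0)` is `|I| φ(u) ∫_B (-y) dN(0, λ₂₀)(y)`, with `φ` the density of `N(0, ρ 0)`
(`lintegral_encard_crossings`). The process `W` is such a `U` plus its mean `m`, almost surely, so
wave centres are crossings of the level `-m` by `U`. In the Palm ratio the factor `φ(-m)` cancels,
and size-biasing `N(0, λ₂₀)` by `y⁻` gives the negative Rayleigh law scaled by `√λ₂₀`.

Rice's formula is obtained at every fixed level without approximating the count. Near `x₀` write `U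
x = r x * Z + f x`, where `Z = U x₀` is independent of the residual path `f` (`indepFun_residual`).
Where `r > 0`, `U x = u` means that `(u - f x) / r x` takes the value `Z`, and down-crossings of `u`
become up-crossings of the random level `Z`. For fixed `f`, averaging over the density of `Z` turns
the count into an integral over `x` by the area formula (`lintegral_levelCount`). Averaging over `f`
then recovers the law of the slope given `U x = u` (`lintegral_gaussianPDF_mul`); this law is
unconditional because value and slope at one point are independent, `ρ` being even.

Almost sure limits of Gaussian variables are Gaussian with convergent variances
(`exists_gaussianReal_of_tendsto_ae`). Hence the slopes are jointly Gaussian with the process and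
`λ₂₀ = lim 2 (ρ 0 - ρ t) / t²`, from which Fatou and domination give the spectral moment
(`integrable_sq_mul_of_tendsto`). -/

/-! ### Level counts and the area formula for up-crossings -/

lemma strictMonoOn_Icc_of_rat {f : ℝ → ℝ} {a b : ℝ} (hf : ContinuousOn f (Icc a b))
    (h : ∀ p q : ℚ, (p : ℝ) ∈ Icc a b → (q : ℝ) ∈ Icc a b → p < q → f p < f q) :
    StrictMonoOn f (Icc a b) := by
  intro x hx y hy hxy
  -- Continuity gives only weak inequalities at `x` and `y`; the strict one comes from two rationals
  -- `p < q` between them.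
  obtain ⟨p, hxp, hpy⟩ := exists_rat_btwn hxy
  obtain ⟨q, hpq, hqy⟩ := exists_rat_btwn hpy
  have hp : (p : ℝ) ∈ Icc a b := ⟨by linarith [hx.1], by linarith [hy.2]⟩
  have hq : (q : ℝ) ∈ Icc a b := ⟨by linarith [hx.1], by linarith [hy.2]⟩
  have h1 : f x ≤ f p := by
    have ht : Filter.Tendsto f (nhdsWithin x (Ioo x p)) (nhds (f x)) :=
      (hf x hx).mono_left (nhdsWithin_mono _ fun t ht => ⟨by linarith [hx.1, ht.1],
        by linarith [hp.2, ht.2]⟩)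
    refine le_of_tendsto_of_frequently ht ?_
    rw [nhdsWithin_Ioo_eq_nhdsGT hxp]
    rw [(nhdsGT_basis x).frequently_iff]
    intro c hc
    obtain ⟨t, ht1, ht2⟩ := exists_rat_btwn (lt_min hc hxp)
    refine ⟨t, ⟨ht1, ht2.trans_le (min_le_left _ _)⟩, ?_⟩
    have htp := ht2.trans_le (min_le_right _ _)
    exact (h t p ⟨by linarith [hx.1], by linarith [hp.2]⟩ hp (by exact_mod_cast htp)).le
  have h2 : f q ≤ f y := by
    have ht : Filter.Tendsto f (nhdsWithin y (Ioo (q : ℝ) y)) (nhds (f y)) :=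
      (hf y hy).mono_left (nhdsWithin_mono _ fun t ht => ⟨by linarith [hq.1, ht.1],
        by linarith [hy.2, ht.2]⟩)
    refine ge_of_tendsto_of_frequently ht ?_
    rw [nhdsWithin_Ioo_eq_nhdsLT hqy]
    rw [(nhdsLT_basis y).frequently_iff]
    intro c hc
    obtain ⟨t, ht1, ht2⟩ := exists_rat_btwn (max_lt hc hqy)
    refine ⟨t, ⟨(le_max_left _ _).trans_lt ht1, ht2⟩, ?_⟩
    have htp := (le_max_right _ _).trans_lt ht1
    exact (h q t hq ⟨by linarith [hq.1], by linarith [hy.2]⟩ (by exact_mod_cast htp)).le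
  exact h1.trans_lt ((h p q hp hq (by exact_mod_cast hpq)).trans_le h2)

/-- The time at which a strictly increasing path on `[a, b)` reaches the level `z`. -/
noncomputable def hittingPoint {α : Type*} (Y : ℝ → α → ℝ) (a b : ℝ) (p : ℝ × α) : ℝ :=
  a + (volume {x | x ∈ Ico a b ∧ Y x p.2 < p.1}).toReal

/-- The hitting point is defined as a length for this purpose: the measure of a section of a
measurable set is measurable in the parameter, here the pair of level and path. -/
lemma measurable_hittingPoint {α : Type*} [MeasurableSpace α]
    {Y : ℝ → α → ℝ} (hY : Measurable (Function.uncurry Y)) (a b : ℝ) :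
    Measurable (hittingPoint Y a b) := by
  have hs : MeasurableSet {q : (ℝ × α) × ℝ | q.2 ∈ Ico a b ∧ Y q.2 q.1.2 < q.1.1} := by
    refine (measurableSet_Ico.preimage measurable_snd).inter ?_
    exact measurableSet_lt (hY.comp (measurable_snd.prodMk (measurable_snd.comp measurable_fst)))
      (measurable_fst.comp measurable_fst)
  exact measurable_const.add (measurable_measure_prodMk_left hs).ennreal_toReal

lemma hittingPoint_eq {α : Type*} {Y : ℝ → α → ℝ} {a b x : ℝ} {ω : α} (hx : x ∈ Ico a b)
    (hm : StrictMonoOn (fun t => Y t ω) (Icc a b)) : hittingPoint Y a b (Y x ω, ω) = x := by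
  have : {t | t ∈ Ico a b ∧ Y t ω < Y x ω} = Ico a x := by
    ext t
    constructor
    · rintro ⟨h1, h2⟩
      exact ⟨h1.1, (hm.lt_iff_lt (Ico_subset_Icc_self h1) (Ico_subset_Icc_self hx)).1 h2⟩
    · rintro ⟨h1, h2⟩
      have h3 : t ∈ Ico a b := ⟨h1, h2.trans hx.2⟩
      exact ⟨h3, (hm.lt_iff_lt (Ico_subset_Icc_self h3) (Ico_subset_Icc_self hx)).2 h2⟩
  simp only [hittingPoint]
  rw [this, Real.volume_Ico, ENNReal.toReal_ofReal (by linarith [hx.1])]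
  ring

/-- Number of points `x` with `(x, ω) ∈ E` at which the path of `ω` is at level `z`. -/
noncomputable def levelCount {α : Type*} (Y : ℝ → α → ℝ) (E : Set (ℝ × α)) (p : ℝ × α) : ℝ≥0∞ :=
  (({x | (x, p.2) ∈ E ∧ Y x p.2 = p.1} : Set ℝ).encard : ℝ≥0∞)

/-- A strictly increasing path meets a level at most once, and a meeting point in `E` can only be
the hitting point; this makes the count visibly measurable. -/
lemma levelCount_of_strictMonoOn {α : Type*} {Y : ℝ → α → ℝ} {a b : ℝ} {E : Set (ℝ × α)}
    (hI : ∀ p ∈ E, p.1 ∈ Ico a b)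
    (hm : ∀ p ∈ E, StrictMonoOn (fun t => Y t p.2) (Icc a b)) :
    levelCount Y E = {p : ℝ × α | (hittingPoint Y a b p, p.2) ∈ E ∧
      Y (hittingPoint Y a b p) p.2 = p.1}.indicator 1 := by
  ext ⟨z, ω⟩
  by_cases h : (hittingPoint Y a b (z, ω), ω) ∈ E ∧ Y (hittingPoint Y a b (z, ω)) ω = z
  · rw [indicator_of_mem (by exact h)]
    have : {x | (x, ω) ∈ E ∧ Y x ω = z} = {hittingPoint Y a b (z, ω)} := by
      ext x
      constructor
      · rintro ⟨h1, h2⟩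
        have := hittingPoint_eq (hI _ h1) (hm _ h1)
        simp only [h2] at this
        exact this.symm
      · rintro rfl
        exact h
    simp [levelCount, this]
  · rw [indicator_of_notMem (by exact h)]
    have : {x | (x, ω) ∈ E ∧ Y x ω = z} = ∅ := by
      ext x
      simp only [mem_ofPred_eq, mem_empty_iff_false, iff_false]
      rintro ⟨h1, h2⟩
      have := hittingPoint_eq (hI _ h1) (hm _ h1)
      simp only [h2] at this
      exact h (by rw [this]; exact ⟨h1, h2⟩)
    simp [levelCount, this]

lemma measurable_levelCount_of_strictMonoOn {α : Type*} [MeasurableSpace α]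
    {Y : ℝ → α → ℝ}
    (hY : Measurable (Function.uncurry Y)) {a b : ℝ} {E : Set (ℝ × α)} (hE : MeasurableSet E)
    (hI : ∀ p ∈ E, p.1 ∈ Ico a b)
    (hm : ∀ p ∈ E, StrictMonoOn (fun t => Y t p.2) (Icc a b)) :
    Measurable (levelCount Y E) := by
  rw [levelCount_of_strictMonoOn hI hm]
  have ht := measurable_hittingPoint hY a b
  refine measurable_one.indicator (MeasurableSet.inter ?_ ?_)
  · exact (ht.prodMk measurable_snd) hE
  · exact measurableSet_eq_fun (hY.comp (ht.prodMk measurable_snd)) measurable_fst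

lemma lintegral_levelCount_of_strictMonoOn {α : Type*} [MeasurableSpace α]
    {Y Y' : ℝ → α → ℝ} {a b : ℝ} {E : Set (ℝ × α)}
    (hE : MeasurableSet E) (hI : ∀ p ∈ E, p.1 ∈ Ico a b)
    (hm : ∀ p ∈ E, StrictMonoOn (fun t => Y t p.2) (Icc a b))
    (hd : ∀ p ∈ E, HasDerivAt (fun t => Y t p.2) (Y' p.1 p.2) p.1)
    (hpos : ∀ p ∈ E, 0 < Y' p.1 p.2) (ω : α) (g : ℝ → ℝ≥0∞) :
    ∫⁻ z, g z * levelCount Y E (z, ω) =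
      ∫⁻ x in {x | (x, ω) ∈ E}, ENNReal.ofReal (Y' x ω) * g (Y x ω) := by
  have hs : MeasurableSet {x | (x, ω) ∈ E} := measurable_prodMk_right hE
  have hinj : InjOn (fun t => Y t ω) {x | (x, ω) ∈ E} := by
    intro x hx y hy hxy
    exact (hm _ hx).injOn (Ico_subset_Icc_self (hI _ hx)) (Ico_subset_Icc_self (hI _ hy)) hxy
  have hd' : ∀ x ∈ {x | (x, ω) ∈ E}, HasDerivWithinAt (fun t => Y t ω) (Y' x ω)
    {x | (x, ω) ∈ E} x := fun x hx => (hd _ hx).hasDerivWithinAt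
  have himg := measurable_image_of_fderivWithin hs (fun x hx => (hd' x hx).hasFDerivWithinAt) hinj
  have h := lintegral_image_eq_lintegral_abs_deriv_mul hs hd' hinj g
  rw [← lintegral_indicator himg] at h
  calc _ = ∫⁻ z, ((fun t => Y t ω) '' {x | (x, ω) ∈ E}).indicator g z := by
        congr 1
        ext z
        by_cases hz : z ∈ (fun t => Y t ω) '' {x | (x, ω) ∈ E}
        · rw [indicator_of_mem hz]
          obtain ⟨x, hx, rfl⟩ := hz
          have : {t | (t, ω) ∈ E ∧ Y t ω = Y x ω} = {x} := by
            ext t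
            exact ⟨fun ht => hinj ht.1 hx ht.2, fun ht => by rw [ht]; exact ⟨hx, rfl⟩⟩
          simp [levelCount, this]
        · rw [indicator_of_notMem hz]
          have : {t | (t, ω) ∈ E ∧ Y t ω = z} = ∅ := by
            ext t
            simp only [mem_ofPred_eq, mem_empty_iff_false, iff_false]
            exact fun ht => hz ⟨t, ht.1, ht.2⟩
          simp [levelCount, this]
    _ = _ := h
    _ = _ := by
        refine setLIntegral_congr_fun hs fun x hx => ?_
        rw [abs_of_pos (hpos _ hx)]

/-- Countable additivity of the counting measure on the sections. -/
lemma levelCount_eq_tsum {α : Type*} [MeasurableSpace α]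
    {Y : ℝ → α → ℝ} (hY : Measurable (Function.uncurry Y))
    {E : ℕ → Set (ℝ × α)} (hE : ∀ n, MeasurableSet (E n)) (hd : Pairwise (Function.onFun Disjoint E))
    (p : ℝ × α) : levelCount Y (⋃ n, E n) p = ∑' n, levelCount Y (E n) p := by
  have hYp : Measurable fun x => Y x p.2 := hY.comp measurable_prodMk_right
  have hm : ∀ n, MeasurableSet {x | (x, p.2) ∈ E n ∧ Y x p.2 = p.1} := fun n =>
    (measurable_prodMk_right (hE n)).inter (hYp (measurableSet_singleton _))
  have : ∀ n, levelCount Y (E n) p = Measure.count {x | (x, p.2) ∈ E n ∧ Y x p.2 = p.1} :=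
    fun n => (Measure.count_apply (hm n)).symm
  simp_rw [this]
  rw [← measure_iUnion _ hm, Measure.count_apply (MeasurableSet.iUnion hm)]
  · have : {x | (x, p.2) ∈ ⋃ n, E n ∧ Y x p.2 = p.1} =
      ⋃ n, {x | (x, p.2) ∈ E n ∧ Y x p.2 = p.1} := by
      ext x
      simp only [mem_ofPred_eq, mem_iUnion, exists_and_right]
    rw [levelCount, this]
  · intro i j hij
    refine Set.disjoint_left.2 fun x hx hx' => ?_
    exact Set.disjoint_left.1 (hd hij) hx.1 hx'.1

/-- Around a point with positive derivative the path increases on an interval with rational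
endpoints inside `O`, and there are countably many of these. Testing monotonicity at rational times
only keeps the pieces measurable. -/
lemma exists_disjoint_strictMonoOn_pieces {α : Type*} [MeasurableSpace α]
    {O : Set ℝ} (hO : IsOpen O) {Y Y' : ℝ → α → ℝ}
    (hY : Measurable (Function.uncurry Y))
    (hd : ∀ ω, ∀ x ∈ O, HasDerivAt (fun t => Y t ω) (Y' x ω) x)
    (hc : ∀ ω, ContinuousOn (fun x => Y' x ω) O) {E : Set (ℝ × α)} (hE : MeasurableSet E)
    (hEO : ∀ p ∈ E, p.1 ∈ O) (hpos : ∀ p ∈ E, 0 < Y' p.1 p.2) :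
    ∃ (F : ℕ → Set (ℝ × α)) (a b : ℕ → ℝ), (∀ n, MeasurableSet (F n)) ∧
      Pairwise (Function.onFun Disjoint F) ∧ ⋃ n, F n = E ∧
      (∀ n, ∀ p ∈ F n, p.1 ∈ Ico (a n) (b n)) ∧
      ∀ n, ∀ p ∈ F n, StrictMonoOn (fun t => Y t p.2) (Icc (a n) (b n)) := by
  classical
  have hYx : ∀ x, Measurable (Y x) := fun x => hY.comp measurable_prodMk_left
  obtain ⟨e, he⟩ := exists_surjective_nat (ℚ × ℚ)
  let G : ℕ → Set (ℝ × α) := fun n =>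
    if Icc ((e n).1 : ℝ) (e n).2 ⊆ O then
      {p | p ∈ E ∧ p.1 ∈ Ico ((e n).1 : ℝ) (e n).2 ∧ ∀ s t : ℚ, (s : ℝ) ∈ Icc ((e n).1 : ℝ) (e n).2 →
        (t : ℝ) ∈ Icc ((e n).1 : ℝ) (e n).2 → s < t → Y s p.2 < Y t p.2} else ∅
  have hGm : ∀ n, MeasurableSet (G n) := by
    intro n
    by_cases hn : Icc ((e n).1 : ℝ) (e n).2 ⊆ O
    · simp only [G, if_pos hn]
      refine hE.inter ((measurable_fst measurableSet_Ico).inter ?_)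
      have : {p : ℝ × α | ∀ s t : ℚ, (s : ℝ) ∈ Icc ((e n).1 : ℝ) (e n).2 →
        (t : ℝ) ∈ Icc ((e n).1 : ℝ) (e n).2 → s < t → Y s p.2 < Y t p.2} =
        ⋂ s : ℚ, ⋂ t : ℚ, ⋂ _ : (s : ℝ) ∈ Icc ((e n).1 : ℝ) (e n).2,
          ⋂ _ : (t : ℝ) ∈ Icc ((e n).1 : ℝ) (e n).2, ⋂ _ : s < t, {p | Y s p.2 < Y t p.2} := by
        ext p; simp only [mem_ofPred_eq, mem_iInter]
      change MeasurableSet {p : ℝ × α | ∀ s t : ℚ, (s : ℝ) ∈ Icc ((e n).1 : ℝ) (e n).2 →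
        (t : ℝ) ∈ Icc ((e n).1 : ℝ) (e n).2 → s < t → Y s p.2 < Y t p.2}
      rw [this]
      refine MeasurableSet.iInter fun s => MeasurableSet.iInter fun t => MeasurableSet.iInter fun _ =>
        MeasurableSet.iInter fun _ => MeasurableSet.iInter fun _ => ?_
      exact measurableSet_lt ((hYx _).comp measurable_snd) ((hYx _).comp measurable_snd)
    · simp only [G, if_neg hn, MeasurableSet.empty]
  have hGI : ∀ n, ∀ p ∈ G n, p ∈ E ∧ p.1 ∈ Ico ((e n).1 : ℝ) (e n).2 ∧
      StrictMonoOn (fun t => Y t p.2) (Icc ((e n).1 : ℝ) (e n).2) := by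
    intro n p hp
    by_cases hn : Icc ((e n).1 : ℝ) (e n).2 ⊆ O
    · simp only [G, if_pos hn] at hp
      exact ⟨hp.1, hp.2.1, strictMonoOn_Icc_of_rat
        (fun x hx => (hd p.2 x (hn hx)).continuousAt.continuousWithinAt) hp.2.2⟩
    · simp [G, if_neg hn] at hp
  have hGE : ⋃ n, G n = E := by
    refine Subset.antisymm (iUnion_subset fun n p hp => (hGI n p hp).1) fun p hp => ?_
    have hmem : {x | x ∈ O ∧ 0 < Y' x p.2} ∈ nhds p.1 := by
      filter_upwards [hO.mem_nhds (hEO p hp), ((hc p.2).continuousAt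
        (hO.mem_nhds (hEO p hp))).eventually (lt_mem_nhds (hpos p hp))] with x h1 h2
      exact ⟨h1, h2⟩
    obtain ⟨l, u, hlu, hsub⟩ := mem_nhds_iff_exists_Ioo_subset.1 hmem
    obtain ⟨s, hs1, hs2⟩ := exists_rat_btwn hlu.1
    obtain ⟨t, ht1, ht2⟩ := exists_rat_btwn hlu.2
    obtain ⟨n, hn⟩ := he (s, t)
    have hsub' : Icc (s : ℝ) t ⊆ {x | x ∈ O ∧ 0 < Y' x p.2} := fun x hx =>
      hsub ⟨hs1.trans_le hx.1, hx.2.trans_lt ht2⟩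
    have hmono : StrictMonoOn (fun x => Y x p.2) (Icc (s : ℝ) t) := by
      refine strictMonoOn_of_deriv_pos (convex_Icc _ _)
        (fun x hx => (hd p.2 x (hsub' hx).1).continuousAt.continuousWithinAt) fun x hx => ?_
      have hx' := hsub' (interior_subset hx)
      rw [(hd p.2 x hx'.1).deriv]
      exact hx'.2
    refine mem_iUnion.2 ⟨n, ?_⟩
    have hn' : Icc ((e n).1 : ℝ) (e n).2 ⊆ O := by
      rw [hn]
      exact fun x hx => (hsub' hx).1
    simp only [G, if_pos hn', hn]
    exact ⟨hp, ⟨hs2.le, ht1⟩, fun x y hx hy hxy => hmono hx hy (by exact_mod_cast hxy)⟩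
  refine ⟨disjointed G, fun n => (e n).1, fun n => (e n).2, fun n => MeasurableSet.disjointed hGm n,
    disjoint_disjointed G, by rw [iUnion_disjointed, hGE], fun n p hp => ?_, fun n p hp => ?_⟩
  · exact (hGI n p (disjointed_subset G n hp)).2.1
  · exact (hGI n p (disjointed_subset G n hp)).2.2

theorem measurable_levelCount {α : Type*} [MeasurableSpace α]
    {O : Set ℝ} (hO : IsOpen O) {Y Y' : ℝ → α → ℝ}
    (hY : Measurable (Function.uncurry Y))
    (hd : ∀ ω, ∀ x ∈ O, HasDerivAt (fun t => Y t ω) (Y' x ω) x)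
    (hc : ∀ ω, ContinuousOn (fun x => Y' x ω) O) {E : Set (ℝ × α)} (hE : MeasurableSet E)
    (hEO : ∀ p ∈ E, p.1 ∈ O) (hpos : ∀ p ∈ E, 0 < Y' p.1 p.2) :
    Measurable (levelCount Y E) := by
  obtain ⟨F, a, b, hF, hdis, rfl, hI, hm⟩ :=
    exists_disjoint_strictMonoOn_pieces hO hY hd hc hE hEO hpos
  have : levelCount Y (⋃ n, F n) = fun p => ∑' n, levelCount Y (F n) p :=
    funext fun p => levelCount_eq_tsum hY hF hdis p
  rw [this]
  exact Measurable.tsum fun n => measurable_levelCount_of_strictMonoOn hY (hF n) (hI n) (hm n)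

/-- Area formula for up-crossings, with the points weighted by a function of the level. -/
theorem lintegral_levelCount {α : Type*} [MeasurableSpace α]
    {O : Set ℝ} (hO : IsOpen O) {Y Y' : ℝ → α → ℝ}
    (hY : Measurable (Function.uncurry Y))
    (hd : ∀ ω, ∀ x ∈ O, HasDerivAt (fun t => Y t ω) (Y' x ω) x)
    (hc : ∀ ω, ContinuousOn (fun x => Y' x ω) O) {E : Set (ℝ × α)} (hE : MeasurableSet E)
    (hEO : ∀ p ∈ E, p.1 ∈ O) (hpos : ∀ p ∈ E, 0 < Y' p.1 p.2) (ω : α) {g : ℝ → ℝ≥0∞}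
    (hg : Measurable g) :
    ∫⁻ z, g z * levelCount Y E (z, ω) =
      ∫⁻ x in {x | (x, ω) ∈ E}, ENNReal.ofReal (Y' x ω) * g (Y x ω) := by
  obtain ⟨F, a, b, hF, hdis, rfl, hI, hm⟩ :=
    exists_disjoint_strictMonoOn_pieces hO hY hd hc hE hEO hpos
  simp_rw [levelCount_eq_tsum hY hF hdis, ← ENNReal.tsum_mul_left]
  have hsub : ∀ n, ∀ p ∈ F n, p ∈ ⋃ n, F n := fun n p hp => mem_iUnion.2 ⟨n, hp⟩
  have hset : {x | (x, ω) ∈ ⋃ n, F n} = ⋃ n, {x | (x, ω) ∈ F n} := by ext x; simp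
  rw [lintegral_tsum, hset, lintegral_iUnion]
  · congr 1
    ext n
    exact lintegral_levelCount_of_strictMonoOn (hF n) (hI n) (hm n)
      (fun p hp => hd p.2 p.1 (hEO p (hsub n p hp))) (fun p hp => hpos p (hsub n p hp)) ω g
  · exact fun n => measurable_prodMk_right (hF n)
  · intro i j hij
    exact Set.disjoint_left.2 fun x hx hx' => Set.disjoint_left.1 (hdis hij) hx hx'
  · exact fun n => (hg.mul ((measurable_levelCount_of_strictMonoOn hY (hF n) (hI n) (hm n)).comp
      measurable_prodMk_right)).aemeasurable

/-! ### Limits of Gaussian variables and processes -/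

lemma tendsto_charFun_of_tendsto_ae {Ω ι : Type*} [MeasurableSpace Ω] {P : Measure Ω}
    [IsProbabilityMeasure P] {l : Filter ι} [l.IsCountablyGenerated] {X : ι → Ω → ℝ} {Y : Ω → ℝ}
    (hX : ∀ i, AEMeasurable (X i) P) (hY : AEMeasurable Y P)
    (h : ∀ᵐ ω ∂P, Filter.Tendsto (fun i => X i ω) l (nhds (Y ω))) (t : ℝ) :
    Filter.Tendsto (fun i => charFun (P.map (X i)) t) l (nhds (charFun (P.map Y) t)) := by
  have key : ∀ Z : Ω → ℝ, AEMeasurable Z P →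
      charFun (P.map Z) t = ∫ ω, Complex.exp (t * Z ω * Complex.I) ∂P := by
    intro Z hZ
    rw [charFun_apply_real, integral_map hZ]
    exact Continuous.aestronglyMeasurable (by fun_prop)
  rw [key Y hY]
  simp_rw [fun i => key (X i) (hX i)]
  refine tendsto_integral_filter_of_dominated_convergence (fun _ => 1) ?_ ?_ (integrable_const _) ?_
  · refine Filter.Eventually.of_forall fun i => ?_
    have := hX i
    exact (by fun_prop : AEMeasurable (fun ω => Complex.exp (t * X i ω * Complex.I)) P).aestronglyMeasurable
  · refine Filter.Eventually.of_forall fun i => Filter.Eventually.of_forall fun ω => ?_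
    have : (t : ℂ) * X i ω * Complex.I = ((t * X i ω : ℝ) : ℂ) * Complex.I := by push_cast; ring
    rw [this, Complex.norm_exp_ofReal_mul_I]
  · filter_upwards [h] with ω hω
    have hc : Continuous fun x : ℝ => Complex.exp (t * x * Complex.I) := by fun_prop
    exact (hc.tendsto _).comp hω

/-- A pointwise limit of centred Gaussian variables is centred Gaussian, and the variances
converge. -/
theorem exists_gaussianReal_of_tendsto_ae {Ω ι : Type*} [MeasurableSpace Ω] {P : Measure Ω}
    [IsProbabilityMeasure P] {l : Filter ι} [l.NeBot] [l.IsCountablyGenerated] {X : ι → Ω → ℝ}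
    {Y : Ω → ℝ} {v : ι → ℝ≥0} (hX : ∀ i, AEMeasurable (X i) P) (hY : AEMeasurable Y P)
    (hv : ∀ i, P.map (X i) = gaussianReal 0 (v i))
    (h : ∀ᵐ ω ∂P, Filter.Tendsto (fun i => X i ω) l (nhds (Y ω))) :
    ∃ w : ℝ≥0, Filter.Tendsto v l (nhds w) ∧ P.map Y = gaussianReal 0 w := by
  have hprob : IsProbabilityMeasure (P.map Y) := Measure.isProbabilityMeasure_map hY
  have hch : ∀ (u : ℝ≥0) (t : ℝ), charFun (gaussianReal 0 u) t =
      ((Real.exp (-(u * t ^ 2 / 2)) : ℝ) : ℂ) := by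
    intro u t
    rw [charFun_gaussianReal]
    push_cast
    congr 1
    simp
  have hlim : ∀ t : ℝ, Filter.Tendsto (fun i => ((Real.exp (-(v i * t ^ 2 / 2)) : ℝ) : ℂ)) l
      (nhds (charFun (P.map Y) t)) := by
    intro t
    have := tendsto_charFun_of_tendsto_ae hX hY h t
    simp_rw [hv, hch] at this
    exact this
  have hcont : Continuous (charFun (P.map Y)) := by
    fun_prop
  -- The variances are read off from the logarithm of the characteristic function at a single `t`;
  -- it must be nonzero there, and `t ≠ 0` is needed to divide by `t ^ 2`.
  have h0 : ∃ t : ℝ, t ≠ 0 ∧ charFun (P.map Y) t ≠ 0 := by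
    have h1 : charFun (P.map Y) 0 ≠ 0 := by simp
    have h2 := hcont.continuousAt.eventually_ne h1
    have h3 : ∃ᶠ t in nhdsWithin (0 : ℝ) {0}ᶜ, t ≠ 0 ∧ charFun (P.map Y) t ≠ 0 := by
      refine Filter.Eventually.frequently ?_
      filter_upwards [nhdsWithin_le_nhds h2, self_mem_nhdsWithin] with t ha hb
      exact ⟨hb, ha⟩
    exact h3.exists
  obtain ⟨t, ht, hc⟩ := h0
  have hre : Filter.Tendsto (fun i => Real.exp (-(v i * t ^ 2 / 2))) l
      (nhds ‖charFun (P.map Y) t‖) := by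
    have := (hlim t).norm
    simpa only [Complex.norm_real, Real.norm_eq_abs, Real.abs_exp] using this
  have hlog := hre.log (norm_ne_zero_iff.2 hc)
  simp_rw [Real.log_exp] at hlog
  have hvr : Filter.Tendsto (fun i => (v i : ℝ)) l
      (nhds (-2 / t ^ 2 * Real.log ‖charFun (P.map Y) t‖)) := by
    refine (hlog.const_mul (-2 / t ^ 2)).congr fun i => ?_
    field_simp
  have hnn : 0 ≤ -2 / t ^ 2 * Real.log ‖charFun (P.map Y) t‖ :=
    ge_of_tendsto' hvr fun i => (v i).2
  obtain ⟨w, hw⟩ : ∃ w : ℝ≥0, (w : ℝ) = -2 / t ^ 2 * Real.log ‖charFun (P.map Y) t‖ :=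
    ⟨⟨_, hnn⟩, rfl⟩
  rw [← hw] at hvr
  refine ⟨w, NNReal.tendsto_coe.1 hvr, ?_⟩
  refine Measure.ext_of_charFun (funext fun s => ?_)
  rw [hch]
  refine tendsto_nhds_unique (hlim s) ?_
  have hc2 : Continuous fun r : ℝ => ((Real.exp (-(r * s ^ 2 / 2)) : ℝ) : ℂ) := by fun_prop
  exact (hc2.tendsto _).comp hvr

/-- The case `s = t` is allowed and serves, with coefficients `1` and `0`, to keep a variable
unchanged. -/
lemma exists_clm_eq_comb {Ω T : Type*} (X : T → Ω → ℝ) (s t : T) (a b : ℝ) :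
    ∃ I : Finset T, ∃ L : (I → ℝ) →L[ℝ] ℝ, ∀ ω, a * X s ω + b * X t ω = L (I.restrict (X · ω)) := by
  classical
  refine ⟨{s, t}, a • ContinuousLinearMap.proj (R := ℝ) (⟨s, by simp⟩ : ({s, t} : Finset T)) +
    b • ContinuousLinearMap.proj (R := ℝ) (⟨t, by simp⟩ : ({s, t} : Finset T)), fun ω => by simp⟩

/-- A Gaussian process all of whose variables are centred. -/
structure IsCentredGaussianProcess {Ω T : Type*} [MeasurableSpace Ω] (X : T → Ω → ℝ)
    (P : Measure Ω) : Prop where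
  gaussian : IsGaussianProcess X P
  mean : ∀ t, P[X t] = 0

namespace IsCentredGaussianProcess

variable {Ω T : Type*} [MeasurableSpace Ω] {P : Measure Ω} {X : T → Ω → ℝ}

lemma memLp (hX : IsCentredGaussianProcess X P) (t : T) : MemLp (X t) 2 P :=
  (hX.gaussian.hasGaussianLaw_eval t).memLp_two

lemma map_eq (hX : IsCentredGaussianProcess X P) (t : T) :
    P.map (X t) = gaussianReal 0 (Var[X t; P]).toNNReal := by
  rw [(hX.gaussian.hasGaussianLaw_eval t).map_eq_gaussianReal, hX.mean]

/-- Finite linear combinations of a centred Gaussian process form a centred Gaussian process. -/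
lemma of_linear (hX : IsCentredGaussianProcess X P) {S : Type*} {Y : S → Ω → ℝ}
    (h : ∀ s, ∃ I : Finset T, ∃ L : (I → ℝ) →L[ℝ] ℝ, ∀ ω, Y s ω = L (I.restrict (X · ω))) :
    IsCentredGaussianProcess Y P := by
  refine ⟨hX.gaussian.of_isGaussianProcess h, fun s => ?_⟩
  obtain ⟨I, L, hL⟩ := h s
  simp_rw [hL]
  have hI := hX.gaussian.hasGaussianLaw I
  have hz : ∫ ω, I.restrict (X · ω) ∂P = 0 := by
    ext i
    have := ContinuousLinearMap.integral_comp_comm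
      (ContinuousLinearMap.proj (R := ℝ) (φ := fun _ : I => ℝ) i) hI.integrable
    exact this.symm.trans (hX.mean i)
  rw [ContinuousLinearMap.integral_comp_comm _ hI.integrable, hz, map_zero]

lemma comp_right (hX : IsCentredGaussianProcess X P) {S : Type*} (f : S → T) :
    IsCentredGaussianProcess (fun s => X (f s)) P :=
  ⟨hX.gaussian.comp_right f, fun s => hX.mean (f s)⟩

lemma variance_comb (hX : IsCentredGaussianProcess X P) (s t : T) (a b : ℝ) :
    Var[fun ω => a * X s ω + b * X t ω; P] =
      a ^ 2 * Var[X s; P] + 2 * (a * b * cov[X s, X t; P]) + b ^ 2 * Var[X t; P] := by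
  have hP := hX.gaussian.isProbabilityMeasure
  rw [variance_fun_add ((hX.memLp s).const_mul a) ((hX.memLp t).const_mul b),
    variance_const_mul, variance_const_mul, covariance_const_mul_left, covariance_const_mul_right]
  ring

section limit

variable {ι : Type*} {l : Filter ι} [l.NeBot] [l.IsCountablyGenerated] {Z : ι → T → Ω → ℝ}

/-- Every linear functional of finitely many variables is a limit of centred Gaussian variables, so
the one-dimensional result suffices. -/
lemma of_tendsto (hZ : ∀ i, IsCentredGaussianProcess (Z i) P) (hX : ∀ t, AEMeasurable (X t) P)
    (h : ∀ t ω, Filter.Tendsto (fun i => Z i t ω) l (nhds (X t ω))) :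
    IsCentredGaussianProcess X P := by
  obtain ⟨i₀⟩ : Nonempty ι := l.nonempty_of_neBot
  have hP := (hZ i₀).gaussian.isProbabilityMeasure
  have key : ∀ (I : Finset T) (L : (I → ℝ) →L[ℝ] ℝ),
      ∃ w : ℝ≥0, P.map (fun ω => L (I.restrict (X · ω))) = gaussianReal 0 w := by
    intro I L
    have hY : ∀ i, IsCentredGaussianProcess (fun (_ : Unit) ω => L (I.restrict (Z i · ω))) P :=
      fun i => (hZ i).of_linear fun _ => ⟨I, L, fun _ => rfl⟩
    have hm : AEMeasurable (fun ω => I.restrict (X · ω)) P :=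
      aemeasurable_pi_lambda _ fun t => hX t
    obtain ⟨w, -, hw⟩ := exists_gaussianReal_of_tendsto_ae (l := l)
      (fun i => (hY i).gaussian.aemeasurable ())
      (L.continuous.measurable.comp_aemeasurable hm) (fun i => (hY i).map_eq ())
      (Filter.Eventually.of_forall fun ω =>
        (L.continuous.tendsto _).comp (tendsto_pi_nhds.2 fun t => h t ω))
    exact ⟨w, hw⟩
  refine ⟨⟨fun I => ⟨isGaussian_of_map_eq_gaussianReal fun L => ?_⟩⟩, fun t => ?_⟩
  · obtain ⟨w, hw⟩ := key I L
    refine ⟨0, w, ?_⟩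
    have hm : AEMeasurable (fun ω => I.restrict (X · ω)) P :=
      aemeasurable_pi_lambda _ fun t => hX t
    rw [AEMeasurable.map_map_of_aemeasurable L.continuous.aemeasurable hm]
    exact hw
  · obtain ⟨w, hw⟩ := key {t} (ContinuousLinearMap.proj ⟨t, by simp⟩)
    have : P[X t] = ∫ x, x ∂(P.map (X t)) := by rw [integral_map (hX t) (by fun_prop)]
    rw [this]
    have hw' : P.map (X t) = gaussianReal 0 w := hw
    rw [hw', integral_id_gaussianReal]

/-- For Gaussian variables pointwise convergence alone controls second moments; no uniform
integrability has to be checked. -/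
lemma tendsto_variance (hZ : ∀ i, IsCentredGaussianProcess (Z i) P)
    (hX : ∀ t, AEMeasurable (X t) P)
    (h : ∀ t ω, Filter.Tendsto (fun i => Z i t ω) l (nhds (X t ω))) (t : T) :
    Filter.Tendsto (fun i => Var[Z i t; P]) l (nhds Var[X t; P]) := by
  obtain ⟨i₀⟩ : Nonempty ι := l.nonempty_of_neBot
  have hP := (hZ i₀).gaussian.isProbabilityMeasure
  obtain ⟨w, hw, hw'⟩ := exists_gaussianReal_of_tendsto_ae (l := l)
      (fun i => (hZ i).gaussian.aemeasurable t) (hX t) (fun i => (hZ i).map_eq t)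
      (Filter.Eventually.of_forall fun ω => h t ω)
  have hv : Var[X t; P] = w := by
    have : Var[X t; P] = Var[id; P.map (X t)] := by
      rw [variance_map aemeasurable_id (hX t)]; rfl
    rw [this, hw', variance_id_gaussianReal]
  rw [hv]
  refine (NNReal.tendsto_coe.2 hw).congr fun i => ?_
  exact Real.coe_toNNReal _ (variance_nonneg _ _)

/-- Polarization of the convergence of variances. -/
lemma tendsto_covariance (hZ : ∀ i, IsCentredGaussianProcess (Z i) P)
    (hX : ∀ t, AEMeasurable (X t) P)
    (h : ∀ t ω, Filter.Tendsto (fun i => Z i t ω) l (nhds (X t ω))) (s t : T) :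
    Filter.Tendsto (fun i => cov[Z i s, Z i t; P]) l (nhds cov[X s, X t; P]) := by
  have hXc := of_tendsto hZ hX h
  have h1 := tendsto_variance hZ hX h s
  have h2 := tendsto_variance hZ hX h t
  have h3 := tendsto_variance (T := Unit) (X := fun _ ω => 1 * X s ω + 1 * X t ω)
    (Z := fun i _ ω => 1 * Z i s ω + 1 * Z i t ω) (l := l)
    (fun i => (hZ i).of_linear fun _ => exists_clm_eq_comb (Z i) s t 1 1)
    (fun _ => ((hX s).const_mul _).add ((hX t).const_mul _))
    (fun _ ω => ((h s ω).const_mul _).add ((h t ω).const_mul _)) ()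
  simp_rw [fun i => (hZ i).variance_comb s t 1 1, hXc.variance_comb s t 1 1] at h3
  have h4 := ((h3.sub h1).sub h2).div_const 2
  refine (h4.congr fun i => ?_).trans_eq ?_
  · ring
  · congr 1; ring

end limit

end IsCentredGaussianProcess

/-! ### Smooth stationary Gaussian processes and their slopes -/

/-- A centred Gaussian process with continuously differentiable paths and stationary covariance
function `ρ`. -/
structure IsSmoothStationaryGaussian {Ω : Type*} [MeasurableSpace Ω] (U : ℝ → Ω → ℝ) (ρ : ℝ → ℝ)
    (P : Measure Ω) : Prop where
  contDiff : ∀ ω, ContDiff ℝ 1 (fun x => U x ω)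
  measurable : ∀ x, Measurable (U x)
  centred : IsCentredGaussianProcess U P
  covariance : ∀ x y, cov[U x, U y; P] = ρ (y - x)

namespace IsSmoothStationaryGaussian

variable {Ω : Type*} [MeasurableSpace Ω] {P : Measure Ω} {U : ℝ → Ω → ℝ} {ρ : ℝ → ℝ}

lemma hasDerivAt (h : IsSmoothStationaryGaussian U ρ P) (x : ℝ) (ω : Ω) :
    HasDerivAt (fun y => U y ω) (pathSlope U x ω) x :=
  ((h.contDiff ω).differentiable one_ne_zero x).hasDerivAt

lemma continuous_pathSlope (h : IsSmoothStationaryGaussian U ρ P) (ω : Ω) :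
    Continuous fun x => pathSlope U x ω :=
  (h.contDiff ω).continuous_deriv le_rfl

lemma tendsto_slope (h : IsSmoothStationaryGaussian U ρ P) (x : ℝ) (ω : Ω) :
    Filter.Tendsto (fun t => t⁻¹ * U (x + t) ω + (-t⁻¹) * U x ω) (nhdsWithin 0 {0}ᶜ)
      (nhds (pathSlope U x ω)) := by
  refine (hasDerivAt_iff_tendsto_slope_zero.1 (h.hasDerivAt x ω)).congr fun t => ?_
  rw [smul_eq_mul]
  ring

lemma measurable_pathSlope (h : IsSmoothStationaryGaussian U ρ P) (x : ℝ) :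
    Measurable (pathSlope U x) := by
  refine measurable_of_tendsto_metrizable' (nhdsWithin 0 {0}ᶜ)
    (f := fun t ω => t⁻¹ * U (x + t) ω + (-t⁻¹) * U x ω) (fun t => ?_)
    (tendsto_pi_nhds.2 fun ω => h.tendsto_slope x ω)
  exact ((h.measurable _).const_mul _).add ((h.measurable _).const_mul _)

/-- Left indices carry values and right indices difference quotients, so that a single limit `t → 0`
makes values and slopes jointly Gaussian. -/
lemma isCentredGaussianProcess_slopes (h : IsSmoothStationaryGaussian U ρ P) (t : ℝ) :
    IsCentredGaussianProcess
      (Sum.elim U fun x ω => t⁻¹ * U (x + t) ω + (-t⁻¹) * U x ω) P := by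
  refine h.centred.of_linear fun s => ?_
  rcases s with x | x
  · obtain ⟨I, L, hL⟩ := exists_clm_eq_comb U x x 1 0
    refine ⟨I, L, fun ω => ?_⟩
    rw [← hL]
    simp
  · exact exists_clm_eq_comb U _ _ _ _

lemma tendsto_slopes (h : IsSmoothStationaryGaussian U ρ P) (s : ℝ ⊕ ℝ) (ω : Ω) :
    Filter.Tendsto
      (fun t => (Sum.elim U fun x ω => t⁻¹ * U (x + t) ω + (-t⁻¹) * U x ω : ℝ ⊕ ℝ → Ω → ℝ) s ω)
      (nhdsWithin 0 {0}ᶜ) (nhds ((Sum.elim U (pathSlope U) : ℝ ⊕ ℝ → Ω → ℝ) s ω)) := by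
  rcases s with x | x
  · exact tendsto_const_nhds
  · exact h.tendsto_slope x ω

lemma aemeasurable_joint (h : IsSmoothStationaryGaussian U ρ P) (s : ℝ ⊕ ℝ) :
    AEMeasurable ((Sum.elim U (pathSlope U) : ℝ ⊕ ℝ → Ω → ℝ) s) P := by
  rcases s with x | x
  · exact (h.measurable x).aemeasurable
  · exact (h.measurable_pathSlope x).aemeasurable

/-- The process and its slope are jointly Gaussian. -/
theorem joint (h : IsSmoothStationaryGaussian U ρ P) :
    IsCentredGaussianProcess (Sum.elim U (pathSlope U)) P :=
  IsCentredGaussianProcess.of_tendsto (l := nhdsWithin 0 {0}ᶜ) h.isCentredGaussianProcess_slopes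
    h.aemeasurable_joint h.tendsto_slopes

lemma even (h : IsSmoothStationaryGaussian U ρ P) (t : ℝ) : ρ (-t) = ρ t := by
  have h1 := h.covariance 0 t
  rw [covariance_comm, h.covariance] at h1
  simpa using h1

lemma variance_eq (h : IsSmoothStationaryGaussian U ρ P) (x : ℝ) : Var[U x; P] = ρ 0 := by
  rw [← covariance_self (h.measurable x).aemeasurable, h.covariance, sub_self]

/-- The expression is exactly the variance of the difference quotient at `x`. As it does not depend
on `x`, neither does the variance of the slope. -/
lemma tendsto_variance_slope (h : IsSmoothStationaryGaussian U ρ P) (x : ℝ) :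
    Filter.Tendsto (fun t => 2 * (ρ 0 - ρ t) / t ^ 2) (nhdsWithin 0 {0}ᶜ)
      (nhds Var[pathSlope U x; P]) := by
  have := IsCentredGaussianProcess.tendsto_variance (l := nhdsWithin 0 {0}ᶜ)
    h.isCentredGaussianProcess_slopes h.aemeasurable_joint h.tendsto_slopes (Sum.inr x)
  refine this.congr fun t => ?_
  simp only [Sum.elim_inr]
  rw [h.centred.variance_comb, h.variance_eq, h.variance_eq, h.covariance, ← h.even (x - (x + t))]
  have : -(x - (x + t)) = t := by ring
  rw [this, div_eq_mul_inv, ← inv_pow]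
  ring

lemma variance_pathSlope (h : IsSmoothStationaryGaussian U ρ P) (x : ℝ) :
    Var[pathSlope U x; P] = Var[pathSlope U 0; P] :=
  tendsto_nhds_unique (h.tendsto_variance_slope x) (h.tendsto_variance_slope 0)

/-- The covariance of a difference quotient of `U` with `U y` is a difference quotient of `ρ`; in
particular `ρ` is differentiable. -/
lemma hasDerivAt_covariance (h : IsSmoothStationaryGaussian U ρ P) (x y : ℝ) :
    HasDerivAt (fun t => ρ (t - y)) cov[pathSlope U x, U y; P] x := by
  have hP := h.centred.gaussian.isProbabilityMeasure
  have := IsCentredGaussianProcess.tendsto_covariance (l := nhdsWithin 0 {0}ᶜ)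
    h.isCentredGaussianProcess_slopes h.aemeasurable_joint h.tendsto_slopes (Sum.inr x) (Sum.inl y)
  rw [hasDerivAt_iff_tendsto_slope_zero]
  refine this.congr fun t => ?_
  simp only [Sum.elim_inr, Sum.elim_inl]
  have hs : (fun ω => t⁻¹ * U (x + t) ω + -t⁻¹ * U x ω) =
    (fun ω => t⁻¹ * U (x + t) ω) + fun ω => -t⁻¹ * U x ω := rfl
  rw [hs, covariance_add_left ((h.centred.memLp _).const_mul _) ((h.centred.memLp _).const_mul _)
    (h.centred.memLp _), covariance_const_mul_left, covariance_const_mul_left, h.covariance,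
    h.covariance, ← h.even (y - (x + t)), ← h.even (y - x), neg_sub, neg_sub, smul_eq_mul]
  ring

/-- The slope is continuous along paths, so the Gaussian limit theorem applies to the pair formed by
the slope and `U y`. It makes `ρ`, and hence the regression coefficient, `C¹`. -/
lemma continuous_covariance_pathSlope (h : IsSmoothStationaryGaussian U ρ P) (y : ℝ) :
    Continuous fun x => cov[pathSlope U x, U y; P] := by
  rw [continuous_iff_continuousAt]
  intro x
  refine IsCentredGaussianProcess.tendsto_covariance (T := Bool) (l := nhds x)
    (Z := fun t b => bif b then pathSlope U t else U y)
    (X := fun b => bif b then pathSlope U x else U y) (fun t => ?_) (fun b => ?_) (fun b ω => ?_)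
    true false
  · have := h.joint.comp_right fun b : Bool => bif b then Sum.inr t else Sum.inl y
    convert this using 2 with b
    cases b <;> rfl
  · cases b
    · exact (h.measurable y).aemeasurable
    · exact (h.measurable_pathSlope x).aemeasurable
  · cases b
    · exact tendsto_const_nhds
    · exact (h.continuous_pathSlope ω).tendsto x

/-- This is the derivative at `x` of `ρ (t - x)`, which is symmetric about `x`, hence equals its own
negative. -/
lemma covariance_pathSlope_self (h : IsSmoothStationaryGaussian U ρ P) (x : ℝ) :
    cov[pathSlope U x, U x; P] = 0 := by
  have h1 := h.hasDerivAt_covariance x x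
  have h2 : HasDerivAt (fun t => 2 * x - t) (-1) x := by
    simpa using (hasDerivAt_id x).const_sub (2 * x)
  have h1' : HasDerivAt (fun t => ρ (t - x)) cov[pathSlope U x, U x; P] (2 * x - x) := by
    convert h1 using 1; ring
  have h3 := h1'.comp x h2
  have h4 : ((fun t => ρ (t - x)) ∘ fun t => 2 * x - t) = fun t => ρ (t - x) := by
    ext t
    simp only [Function.comp]
    rw [← h.even]
    congr 1; ring
  rw [h4] at h3
  linarith [h3.unique h1]

lemma indepFun_pathSlope (h : IsSmoothStationaryGaussian U ρ P) (x : ℝ) :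
    IndepFun (pathSlope U x) (U x) P :=
  (h.joint.gaussian.hasGaussianLaw_prodMk (s := Sum.inr x)
    (t := Sum.inl x)).indepFun_of_covariance_eq_zero (h.covariance_pathSlope_self x)

lemma map_eq (h : IsSmoothStationaryGaussian U ρ P) (x : ℝ) :
    P.map (U x) = gaussianReal 0 (ρ 0).toNNReal := by
  rw [h.centred.map_eq, h.variance_eq]

lemma map_pathSlope (h : IsSmoothStationaryGaussian U ρ P) (x : ℝ) :
    P.map (pathSlope U x) = gaussianReal 0 (Var[pathSlope U 0; P]).toNNReal := by
  have := h.joint.map_eq (Sum.inr x)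
  simp only [Sum.elim_inr] at this
  rw [this, h.variance_pathSlope]

/-- If `ρ 0 = 0`, each `U x` vanishes almost surely, so `ρ = 0` everywhere and the limit giving the
variance of the slope is zero. -/
lemma pos (h : IsSmoothStationaryGaussian U ρ P) (hl : 0 < Var[pathSlope U 0; P]) : 0 < ρ 0 := by
  have hP := h.centred.gaussian.isProbabilityMeasure
  have h0 : 0 ≤ ρ 0 := h.variance_eq 0 ▸ variance_nonneg _ _
  refine h0.lt_of_ne' fun hz => hl.ne' ?_
  have hU : ∀ x, U x =ᵐ[P] 0 := by
    intro x
    have := (ae_eq_integral_of_variance_eq_zero (h.centred.memLp x)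
      (by rw [h.variance_eq, hz]))
    rw [h.centred.mean] at this
    exact this
  have hρ : ∀ t, ρ t = 0 := by
    intro t
    have := h.covariance 0 t
    rw [sub_zero] at this
    rw [← this, covariance_eq_sub (h.centred.memLp 0) (h.centred.memLp t), h.centred.mean, zero_mul,
      sub_zero]
    refine integral_eq_zero_of_ae ?_
    filter_upwards [hU 0] with ω hω
    simp [hω]
  refine tendsto_nhds_unique (h.tendsto_variance_slope 0) ?_
  simp only [hρ, sub_zero, mul_zero, zero_div]
  exact tendsto_const_nhds

/-! ### Regression on one value -/

/-- Linear regression of `U x` on `U x₀`: the coefficient. -/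
noncomputable def regressionCoeff (ρ : ℝ → ℝ) (x₀ x : ℝ) : ℝ := ρ (x - x₀) / ρ 0

/-- The residual of the regression on the value at `x₀`. -/
noncomputable def residual (U : ℝ → Ω → ℝ) (ρ : ℝ → ℝ) (x₀ x : ℝ) (ω : Ω) : ℝ :=
  U x ω - regressionCoeff ρ x₀ x * U x₀ ω

lemma contDiff_regressionCoeff (h : IsSmoothStationaryGaussian U ρ P) (x₀ : ℝ) :
    ContDiff ℝ 1 (regressionCoeff ρ x₀) := by
  have hd : ∀ x, HasDerivAt (regressionCoeff ρ x₀) (cov[pathSlope U x, U x₀; P] / ρ 0) x :=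
    fun x => (h.hasDerivAt_covariance x x₀).div_const _
  rw [contDiff_one_iff_deriv]
  refine ⟨fun x => (hd x).differentiableAt, ?_⟩
  have : deriv (regressionCoeff ρ x₀) = fun x => cov[pathSlope U x, U x₀; P] / ρ 0 :=
    funext fun x => (hd x).deriv
  rw [this]
  exact (h.continuous_covariance_pathSlope x₀).div_const _

lemma measurable_residual (h : IsSmoothStationaryGaussian U ρ P) (x₀ x : ℝ) :
    Measurable (residual U ρ x₀ x) :=
  (h.measurable x).sub ((h.measurable x₀).const_mul _)

lemma contDiff_residual (h : IsSmoothStationaryGaussian U ρ P) (x₀ : ℝ) (ω : Ω) :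
    ContDiff ℝ 1 (fun x => residual U ρ x₀ x ω) :=
  (h.contDiff ω).sub ((h.contDiff_regressionCoeff x₀).mul contDiff_const)

/-- The value at `x₀` is independent of the residual path. -/
theorem indepFun_residual (h : IsSmoothStationaryGaussian U ρ P) (hρ : ρ 0 ≠ 0) (x₀ : ℝ) :
    IndepFun (U x₀) (fun ω x => residual U ρ x₀ x ω) P := by
  have hP := h.centred.gaussian.isProbabilityMeasure
  have hg : IsGaussianProcess (Sum.elim (fun _ : Unit => U x₀) (residual U ρ x₀)) P := by
    refine (h.centred.of_linear fun s => ?_).gaussian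
    rcases s with x | x
    · obtain ⟨I, L, hL⟩ := exists_clm_eq_comb U x₀ x₀ 1 0
      refine ⟨I, L, fun ω => ?_⟩
      rw [← hL]
      simp
    · obtain ⟨I, L, hL⟩ := exists_clm_eq_comb U x x₀ 1 (-regressionCoeff ρ x₀ x)
      refine ⟨I, L, fun ω => ?_⟩
      rw [← hL]
      simp only [Sum.elim_inr, residual]
      ring
  have hi := hg.indepFun_of_covariance_eq_zero (fun _ => (h.measurable x₀).aemeasurable)
    (fun x => (h.measurable_residual x₀ x).aemeasurable) fun _ x => by
      have : residual U ρ x₀ x = fun ω => U x ω - regressionCoeff ρ x₀ x * U x₀ ω := rfl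
      rw [this, covariance_fun_sub_right (h.centred.memLp _) (h.centred.memLp _)
        ((h.centred.memLp _).const_mul _), covariance_const_mul_right, h.covariance, h.covariance,
        regressionCoeff, sub_self, div_mul_cancel₀ _ hρ, sub_self]
  exact hi.comp (φ := fun f : Unit → ℝ => f ()) (measurable_pi_apply ()) measurable_id

end IsSmoothStationaryGaussian

/-! ### Conditioning on a level by Gaussian substitution -/

lemma lintegral_eq_ofReal_mul_lintegral_affine {r : ℝ} (hr : 0 < r) (a : ℝ) (g : ℝ → ℝ≥0∞) :
    ∫⁻ u, g u = ENNReal.ofReal r * ∫⁻ z, g (r * z + a) := by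
  have hd : ∀ x ∈ (univ : Set ℝ), HasDerivWithinAt (fun z => r * z + a) r univ x := by
    intro x _
    have h : HasDerivAt (fun z => r * z + a) r x := by
      simpa using ((hasDerivAt_id x).const_mul r).add_const a
    exact h.hasDerivWithinAt
  have hinj : InjOn (fun z => r * z + a) univ := by
    intro x _ y _ hxy
    simpa [hr.ne'] using hxy
  have himg : (fun z => r * z + a) '' univ = univ := by
    refine image_univ_of_surjective fun y => ⟨(y - a) / r, ?_⟩
    field_simp
    ring
  have h := lintegral_image_eq_lintegral_abs_deriv_mul MeasurableSet.univ hd hinj g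
  rw [himg, Measure.restrict_univ, abs_of_pos hr, lintegral_const_mul' _ _ ENNReal.ofReal_ne_top] at h
  exact h

lemma lintegral_gaussianReal {v : ℝ≥0} (hv : v ≠ 0) (m : ℝ) {g : ℝ → ℝ≥0∞} (hg : Measurable g) :
    ∫⁻ z, g z ∂(gaussianReal m v) = ∫⁻ z, gaussianPDF m v z * g z := by
  rw [gaussianReal_of_var_ne_zero _ hv,
    lintegral_withDensity_eq_lintegral_mul _ (measurable_gaussianPDF _ _) hg]
  rfl

lemma gaussianPDFReal_le (m : ℝ) (v : ℝ≥0) (x : ℝ) :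
    gaussianPDFReal m v x ≤ (√(2 * Real.pi * v))⁻¹ := by
  rw [gaussianPDFReal]
  refine mul_le_of_le_one_right (by positivity) (Real.exp_le_one_iff.2 ?_)
  rw [neg_div]
  exact neg_nonpos.2 (by positivity)

lemma continuous_gaussianPDFReal (m : ℝ) (v : ℝ≥0) : Continuous (gaussianPDFReal m v) := by
  unfold gaussianPDFReal
  fun_prop

section substitution

variable {Ω : Type*} [MeasurableSpace Ω] {P : Measure Ω} [IsProbabilityMeasure P]
  {Z A B D D' : Ω → ℝ} {r s : ℝ} {v : ℝ≥0}

/-- Both sides are `r` times `E[G(D'); D ∈ K]`: on the left by substituting `u = r z + A` and using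
that `Z` is independent of `(A, B)`, on the right because `D'` is independent of `D`. -/
lemma setLIntegral_lintegral_gaussianPDF_mul (hZ : Measurable Z) (hA : Measurable A)
    (hB : Measurable B) (hind : IndepFun Z (fun ω => (A ω, B ω)) P) (hr : 0 < r) (hv : v ≠ 0)
    (hZl : P.map Z = gaussianReal 0 v) (hD : ∀ ω, D ω = r * Z ω + A ω)
    (hD' : ∀ ω, D' ω = s * Z ω + B ω) (hDl : P.map D = gaussianReal 0 v)
    (hDD : IndepFun D' D P) {G : ℝ → ℝ≥0∞} (hG : Measurable G) {K : Set ℝ} (hK : MeasurableSet K) :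
    ∫⁻ u in K, ∫⁻ ω, gaussianPDF 0 v ((u - A ω) / r) * G (B ω + s * ((u - A ω) / r)) ∂P =
      ∫⁻ u in K, ENNReal.ofReal r * gaussianPDF 0 v u * ∫⁻ ω, G (D' ω) ∂P := by
  have hDm : Measurable D := by rw [funext hD]; exact (hZ.const_mul _).add hA
  have hDm' : Measurable D' := by rw [funext hD']; exact (hZ.const_mul _).add hB
  have hφ := measurable_gaussianPDF 0 v
  have hK1 : Measurable (K.indicator (1 : ℝ → ℝ≥0∞)) := measurable_one.indicator hK
  have hR : ∫⁻ u in K, ENNReal.ofReal r * gaussianPDF 0 v u * ∫⁻ ω, G (D' ω) ∂P =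
      ENNReal.ofReal r * ∫⁻ ω, G (D' ω) * K.indicator 1 (D ω) ∂P := by
    rw [lintegral_mul_const _ (hφ.const_mul _), lintegral_const_mul _ hφ,
      ← gaussianReal_apply _ hv K, mul_assoc]
    congr 1
    have := lintegral_mul_eq_lintegral_mul_lintegral_of_indepFun (μ := P) (hG.comp hDm')
      (hK1.comp hDm) (hDD.comp hG hK1)
    simp only [Pi.mul_apply, Function.comp] at this
    rw [this, mul_comm]
    congr 1
    rw [← hDl, ← lintegral_indicator_one hK, lintegral_map hK1 hDm]
  rw [hR, lintegral_lintegral_swap]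
  swap
  · refine Measurable.aemeasurable ?_
    have h1 : Measurable fun p : ℝ × Ω => (p.1 - A p.2) / r :=
      (measurable_fst.sub (hA.comp measurable_snd)).div_const r
    exact (hφ.comp h1).mul (hG.comp ((hB.comp measurable_snd).add (h1.const_mul s)))
  have hin : ∀ ω, ∫⁻ u in K, gaussianPDF 0 v ((u - A ω) / r) * G (B ω + s * ((u - A ω) / r)) =
      ENNReal.ofReal r * ∫⁻ z, G (s * z + B ω) * K.indicator 1 (r * z + A ω) ∂(gaussianReal 0 v) := by
    intro ω
    rw [lintegral_gaussianReal hv, ← lintegral_indicator hK,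
      lintegral_eq_ofReal_mul_lintegral_affine hr (A ω)]
    · congr 2
      ext z
      have : (r * z + A ω - A ω) / r = z := by field_simp; ring
      by_cases hz : r * z + A ω ∈ K
      · rw [indicator_of_mem hz, indicator_of_mem hz, this, add_comm (B ω)]
        simp
      · rw [indicator_of_notMem hz, indicator_of_notMem hz]
        simp
    · exact (hG.comp (by fun_prop)).mul (hK1.comp (by fun_prop))
  simp_rw [hin]
  rw [lintegral_const_mul' _ _ ENNReal.ofReal_ne_top]
  congr 1
  have hF : Measurable fun p : ℝ × (ℝ × ℝ) =>
      G (s * p.1 + p.2.2) * K.indicator 1 (r * p.1 + p.2.1) :=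
    (hG.comp (by fun_prop)).mul (hK1.comp (by fun_prop))
  have hAB : Measurable fun ω => (A ω, B ω) := hA.prodMk hB
  have hprod := (indepFun_iff_map_prod_eq_prod_map_map hZ.aemeasurable hAB.aemeasurable).1 hind
  have hpm : IsProbabilityMeasure (P.map fun ω => (A ω, B ω)) :=
    Measure.isProbabilityMeasure_map hAB.aemeasurable
  calc _ = ∫⁻ q, ∫⁻ z, G (s * z + q.2) * K.indicator 1 (r * z + q.1) ∂(gaussianReal 0 v)
          ∂(P.map fun ω => (A ω, B ω)) := by
        rw [lintegral_map _ hAB]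
        exact (hF.comp measurable_swap).lintegral_prod_right'
    _ = ∫⁻ p : ℝ × (ℝ × ℝ), G (s * p.1 + p.2.2) * K.indicator 1 (r * p.1 + p.2.1)
          ∂(P.map fun ω => (Z ω, (A ω, B ω))) := by
        rw [hprod, hZl, lintegral_prod_symm _ hF.aemeasurable]
    _ = _ := by
        rw [lintegral_map hF (hZ.prodMk hAB)]
        refine lintegral_congr fun ω => ?_
        rw [hD, hD']

lemma continuous_lintegral_gaussianPDF_mul (hA : Measurable A) (hB : Measurable B)
    (G : BoundedContinuousFunction ℝ ℝ≥0) :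
    Continuous fun u => ∫⁻ ω, gaussianPDF 0 v ((u - A ω) / r) *
      (G (B ω + s * ((u - A ω) / r)) : ℝ≥0∞) ∂P := by
  have heq : ∀ u ω, gaussianPDF 0 v ((u - A ω) / r) * (G (B ω + s * ((u - A ω) / r)) : ℝ≥0∞) =
      ENNReal.ofReal (gaussianPDFReal 0 v ((u - A ω) / r) * G (B ω + s * ((u - A ω) / r))) := by
    intro u ω
    rw [ENNReal.ofReal_mul (gaussianPDFReal_nonneg _ _ _), ENNReal.ofReal_coe_nnreal]
    rfl
  simp_rw [heq]
  have hφ := continuous_gaussianPDFReal 0 v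
  have hGc : Continuous fun x => (G x : ℝ) := NNReal.continuous_coe.comp G.continuous
  obtain ⟨M, hM⟩ : ∃ M : ℝ, ∀ x, (G x : ℝ) ≤ M := by
    obtain ⟨C, hC⟩ := G.isBounded_range.bddAbove
    exact ⟨C, fun x => by exact_mod_cast hC ⟨x, rfl⟩⟩
  rw [continuous_iff_continuousAt]
  intro u
  refine tendsto_lintegral_filter_of_dominated_convergence
    (fun _ => ENNReal.ofReal ((√(2 * Real.pi * v))⁻¹ * M)) ?_ ?_ (by simp) ?_
  · refine Filter.Eventually.of_forall fun u => ?_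
    refine Measurable.ennreal_ofReal ?_
    have h1 : Measurable fun ω => (u - A ω) / r := (measurable_const.sub hA).div_const r
    exact (hφ.measurable.comp h1).mul (hGc.measurable.comp (hB.add (h1.const_mul s)))
  · refine Filter.Eventually.of_forall fun u => Filter.Eventually.of_forall fun ω => ?_
    refine ENNReal.ofReal_le_ofReal ?_
    exact mul_le_mul (gaussianPDFReal_le _ _ _) (hM _) (G _).2 (by positivity)
  · refine Filter.Eventually.of_forall fun ω => ?_
    have : Continuous fun u => ENNReal.ofReal (gaussianPDFReal 0 v ((u - A ω) / r) *
        G (B ω + s * ((u - A ω) / r))) :=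
      ENNReal.continuous_ofReal.comp ((hφ.comp (by fun_prop)).mul (hGc.comp (by fun_prop)))
    exact this.tendsto u

/-- Conditioning on `D = r Z + A = u` by substituting `Z = (u - A) / r`: the law of
`D' = s Z + B`, which is independent of `D`, is recovered. -/
theorem lintegral_gaussianPDF_mul (hZ : Measurable Z) (hA : Measurable A)
    (hB : Measurable B) (hind : IndepFun Z (fun ω => (A ω, B ω)) P) (hr : 0 < r) (hv : v ≠ 0)
    (hZl : P.map Z = gaussianReal 0 v) (hD : ∀ ω, D ω = r * Z ω + A ω)
    (hD' : ∀ ω, D' ω = s * Z ω + B ω) (hDl : P.map D = gaussianReal 0 v)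
    (hDD : IndepFun D' D P) (u : ℝ) {G : ℝ → ℝ≥0∞} (hG : Measurable G) :
    ∫⁻ ω, gaussianPDF 0 v ((u - A ω) / r) * G (B ω + s * ((u - A ω) / r)) ∂P =
      ENNReal.ofReal r * gaussianPDF 0 v u * ∫⁻ ω, G (D' ω) ∂P := by
  have hDm' : Measurable D' := by rw [funext hD']; exact (hZ.const_mul _).add hB
  -- For bounded continuous `G` both sides are continuous in `u`, so equality for almost every `u`
  -- becomes equality at the given level.
  have hbc : ∀ G : BoundedContinuousFunction ℝ ℝ≥0,
      ∫⁻ ω, gaussianPDF 0 v ((u - A ω) / r) * (G (B ω + s * ((u - A ω) / r)) : ℝ≥0∞) ∂P =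
      ENNReal.ofReal r * gaussianPDF 0 v u * ∫⁻ ω, (G (D' ω) : ℝ≥0∞) ∂P := by
    intro G
    have hGm : Measurable fun x => (G x : ℝ≥0∞) := G.continuous.measurable.coe_nnreal_ennreal
    have hc1 := continuous_lintegral_gaussianPDF_mul (P := P) (v := v) (r := r) (s := s) hA hB G
    have hfin : ∫⁻ ω, (G (D' ω) : ℝ≥0∞) ∂P ≠ ∞ := by
      obtain ⟨C, hC⟩ := G.isBounded_range.bddAbove
      refine ne_top_of_le_ne_top (b := (C : ℝ≥0∞)) ENNReal.coe_ne_top ?_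
      calc _ ≤ ∫⁻ _, (C : ℝ≥0∞) ∂P :=
            lintegral_mono fun ω => ENNReal.coe_le_coe.2 (hC ⟨_, rfl⟩)
        _ = C := by simp
    have hc2 : Continuous fun u => ENNReal.ofReal r * gaussianPDF 0 v u *
        ∫⁻ ω, (G (D' ω) : ℝ≥0∞) ∂P := by
      have : Continuous (gaussianPDF 0 v) :=
        ENNReal.continuous_ofReal.comp (continuous_gaussianPDFReal 0 v)
      exact (ENNReal.continuous_mul_const hfin).comp
        ((ENNReal.continuous_const_mul ENNReal.ofReal_ne_top).comp this)
    have hae := ae_eq_of_forall_setLIntegral_eq_of_sigmaFinite (μ := (volume : Measure ℝ))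
      hc1.measurable hc2.measurable fun K hK _ => setLIntegral_lintegral_gaussianPDF_mul hZ hA hB
        hind hr hv hZl hD hD' hDl hDD hGm hK
    exact congrFun ((hc1.ae_eq_iff_eq volume hc2).1 hae) u
  have h1 : Measurable fun ω => (u - A ω) / r := (measurable_const.sub hA).div_const r
  have hφ : Measurable fun ω => gaussianPDF 0 v ((u - A ω) / r) :=
    (measurable_gaussianPDF 0 v).comp h1
  have hC : Measurable fun ω => B ω + s * ((u - A ω) / r) := hB.add (h1.const_mul s)
  have e1 : ∀ F : ℝ → ℝ≥0∞, Measurable F →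
      ∫⁻ x, F x ∂((P.withDensity fun ω => gaussianPDF 0 v ((u - A ω) / r)).map
        fun ω => B ω + s * ((u - A ω) / r)) =
      ∫⁻ ω, gaussianPDF 0 v ((u - A ω) / r) * F (B ω + s * ((u - A ω) / r)) ∂P := by
    intro F hF
    rw [lintegral_map hF hC]
    exact lintegral_withDensity_eq_lintegral_mul _ hφ (hF.comp hC)
  have e2 : ∀ F : ℝ → ℝ≥0∞, Measurable F →
      ∫⁻ x, F x ∂((ENNReal.ofReal r * gaussianPDF 0 v u) • P.map D') =
      ENNReal.ofReal r * gaussianPDF 0 v u * ∫⁻ ω, F (D' ω) ∂P := by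
    intro F hF
    rw [lintegral_smul_measure, lintegral_map hF hDm', smul_eq_mul]
  have hfin2 : IsFiniteMeasure ((ENNReal.ofReal r * gaussianPDF 0 v u) • P.map D') := by
    have := Measure.isProbabilityMeasure_map (μ := P) hDm'.aemeasurable
    exact Measure.smul_finite _ (ENNReal.mul_ne_top ENNReal.ofReal_ne_top gaussianPDF_ne_top)
  have hfin1 : IsFiniteMeasure ((P.withDensity fun ω => gaussianPDF 0 v ((u - A ω) / r)).map
        fun ω => B ω + s * ((u - A ω) / r)) := by
    refine ⟨?_⟩
    -- Taking `G = 1` gives the total mass.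
    have h := hbc (BoundedContinuousFunction.const ℝ 1)
    have h' := e1 (fun _ => 1) measurable_const
    simp only [BoundedContinuousFunction.const_apply, ENNReal.coe_one, mul_one, lintegral_const,
      measure_univ, one_mul] at h h'
    rw [h', h]
    exact (ENNReal.mul_ne_top ENNReal.ofReal_ne_top gaussianPDF_ne_top).lt_top
  -- Finite measures with the same integrals of bounded continuous functions coincide, which covers
  -- every measurable `G`.
  have hμ : (P.withDensity fun ω => gaussianPDF 0 v ((u - A ω) / r)).map
        (fun ω => B ω + s * ((u - A ω) / r)) = (ENNReal.ofReal r * gaussianPDF 0 v u) • P.map D' := by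
    refine ext_of_forall_lintegral_eq_of_IsFiniteMeasure fun G => ?_
    have hGm : Measurable fun x => (G x : ℝ≥0∞) := G.continuous.measurable.coe_nnreal_ennreal
    rw [e1 _ hGm, e2 _ hGm]
    exact hbc G
  rw [← e1 G hG, ← e2 G hG, hμ]

end substitution

/-! ### The space of residual paths and the level-solving ratio -/

/-- Continuously differentiable paths, with the σ-algebra generated by the evaluations. -/
abbrev C1Path : Type := {f : ℝ → ℝ // ContDiff ℝ 1 f}

namespace C1Path

lemma measurable_eval (x : ℝ) : Measurable fun f : C1Path => f.1 x :=
  (measurable_pi_apply x).comp measurable_subtype_coe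

lemma hasDerivAt (f : C1Path) (x : ℝ) : HasDerivAt f.1 (deriv f.1 x) x :=
  (f.2.differentiable one_ne_zero x).hasDerivAt

lemma continuous_deriv (f : C1Path) : Continuous (deriv f.1) := f.2.continuous_deriv le_rfl

lemma measurable_deriv_eval (x : ℝ) : Measurable fun f : C1Path => deriv f.1 x := by
  refine measurable_of_tendsto_metrizable' (nhdsWithin 0 {0}ᶜ)
    (f := fun t (f : C1Path) => t⁻¹ • (f.1 (x + t) - f.1 x)) (fun t => ?_)
    (tendsto_pi_nhds.2 fun f => hasDerivAt_iff_tendsto_slope_zero.1 (f.hasDerivAt x))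
  have : Measurable fun f : C1Path => f.1 (x + t) - f.1 x :=
    (measurable_eval _).sub (measurable_eval _)
  exact this.const_smul t⁻¹

lemma measurable_uncurry_eval : Measurable fun p : ℝ × C1Path => p.2.1 p.1 :=
  measurable_uncurry_of_continuous_of_measurable (u := fun x (f : C1Path) => f.1 x)
    (fun f => f.2.continuous) measurable_eval

lemma measurable_uncurry_deriv : Measurable fun p : ℝ × C1Path => deriv p.2.1 p.1 :=
  measurable_uncurry_of_continuous_of_measurable (u := fun x (f : C1Path) => deriv f.1 x)
    continuous_deriv measurable_deriv_eval

/-- The level that `Z` must take for `r Z + f` to be at `u`. -/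
noncomputable def ratio (u : ℝ) (r : ℝ → ℝ) (x : ℝ) (f : C1Path) : ℝ := (u - f.1 x) / r x

/-- The derivative of `ratio` in the point. -/
noncomputable def ratioDeriv (u : ℝ) (r : ℝ → ℝ) (x : ℝ) (f : C1Path) : ℝ :=
  -(deriv f.1 x + deriv r x * ratio u r x f) / r x

variable {u : ℝ} {r : ℝ → ℝ}

lemma measurable_ratio (hr : ContDiff ℝ 1 r) : Measurable (Function.uncurry (ratio u r)) :=
  (measurable_const.sub measurable_uncurry_eval).div (hr.continuous.measurable.comp measurable_fst)

lemma measurable_ratioDeriv (hr : ContDiff ℝ 1 r) :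
    Measurable (Function.uncurry (ratioDeriv u r)) :=
  (measurable_uncurry_deriv.add (((hr.continuous_deriv le_rfl).measurable.comp measurable_fst).mul
    (measurable_ratio hr))).neg.div (hr.continuous.measurable.comp measurable_fst)

lemma hasDerivAt_ratio (hr : ContDiff ℝ 1 r) (f : C1Path) {x : ℝ} (hx : r x ≠ 0) :
    HasDerivAt (fun t => ratio u r t f) (ratioDeriv u r x f) x := by
  have h1 := ((f.hasDerivAt x).const_sub u).div
    (hr.differentiable one_ne_zero x).hasDerivAt hx
  refine h1.congr_deriv ?_
  unfold ratioDeriv ratio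
  field_simp
  ring

lemma continuousOn_ratioDeriv (hr : ContDiff ℝ 1 r) (f : C1Path) :
    ContinuousOn (fun x => ratioDeriv u r x f) {x | r x ≠ 0} := by
  have h1 : ContinuousOn (fun x => ratio u r x f) {x | r x ≠ 0} := fun x hx =>
    (hasDerivAt_ratio hr f hx).continuousAt.continuousWithinAt
  exact ((f.continuous_deriv.continuousOn.add
    ((hr.continuous_deriv le_rfl).continuousOn.mul h1)).neg).div hr.continuous.continuousOn
    fun x hx => hx

/-- The pairs of a point of `I` and a path for which the slope of `r Z + f`, at a crossing
of the level `u` there, belongs to `B`. -/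
def slopeSet (u : ℝ) (r : ℝ → ℝ) (I B : Set ℝ) : Set (ℝ × C1Path) :=
  {p | p.1 ∈ I ∧ deriv p.2.1 p.1 + deriv r p.1 * ratio u r p.1 p.2 ∈ B}

lemma measurableSet_slopeSet (hr : ContDiff ℝ 1 r) {I B : Set ℝ} (hI : MeasurableSet I)
    (hB : MeasurableSet B) : MeasurableSet (slopeSet u r I B) :=
  (measurable_fst hI).inter ((measurable_uncurry_deriv.add
    (((hr.continuous_deriv le_rfl).measurable.comp measurable_fst).mul (measurable_ratio hr))) hB)

/-- The sign flips: a negative slope of `r Z + f` is a positive slope of `ratio`, which is why the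
area formula is needed for up-crossings only. -/
lemma ratioDeriv_pos {I B : Set ℝ} (hI : ∀ x ∈ I, 0 < r x) (hB : B ⊆ Iio 0) {p : ℝ × C1Path}
    (hp : p ∈ slopeSet u r I B) : 0 < ratioDeriv u r p.1 p.2 :=
  div_pos (neg_pos.2 (hB hp.2)) (hI _ hp.1)

end C1Path

/-! ### Rice's formula with marks -/

namespace IsSmoothStationaryGaussian

variable {Ω : Type*} [MeasurableSpace Ω] {P : Measure Ω} {U : ℝ → Ω → ℝ} {ρ : ℝ → ℝ}

/-- The residual path of the regression on the value at `x₀`. -/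
noncomputable def residualPath (h : IsSmoothStationaryGaussian U ρ P) (x₀ : ℝ) (ω : Ω) : C1Path :=
  ⟨fun x => residual U ρ x₀ x ω, h.contDiff_residual x₀ ω⟩

lemma measurable_residualPath (h : IsSmoothStationaryGaussian U ρ P) (x₀ : ℝ) :
    Measurable (h.residualPath x₀) :=
  (measurable_pi_lambda _ fun x => h.measurable_residual x₀ x).subtype_mk

lemma indepFun_residualPath (h : IsSmoothStationaryGaussian U ρ P) (hρ : ρ 0 ≠ 0) (x₀ : ℝ) :
    IndepFun (U x₀) (h.residualPath x₀) P := by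
  have := h.indepFun_residual hρ x₀
  rw [IndepFun_iff_Indep] at this ⊢
  have hc : MeasurableSpace.comap (h.residualPath x₀) inferInstance =
      MeasurableSpace.comap (fun ω x => residual U ρ x₀ x ω) MeasurableSpace.pi := by
    change MeasurableSpace.comap (h.residualPath x₀)
      (MeasurableSpace.comap Subtype.val MeasurableSpace.pi) = _
    rw [MeasurableSpace.comap_comp]
    rfl
  rw [hc]
  exact this

lemma eq_regression (h : IsSmoothStationaryGaussian U ρ P) (x₀ x : ℝ) (ω : Ω) :
    U x ω = regressionCoeff ρ x₀ x * U x₀ ω + (h.residualPath x₀ ω).1 x := by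
  simp only [residualPath, residual]
  ring

lemma pathSlope_eq_regression (h : IsSmoothStationaryGaussian U ρ P) (x₀ x : ℝ) (ω : Ω) :
    pathSlope U x ω =
      deriv (regressionCoeff ρ x₀) x * U x₀ ω + deriv (h.residualPath x₀ ω).1 x := by
  have h1 := ((h.contDiff_regressionCoeff x₀).differentiable one_ne_zero x).hasDerivAt
  have h2 := (h1.mul_const (U x₀ ω)).add ((h.residualPath x₀ ω).hasDerivAt x)
  refine (h.hasDerivAt x ω).unique (h2.congr_of_eventuallyEq ?_)
  exact Filter.Eventually.of_forall fun y => h.eq_regression x₀ y ω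

/-- Solve `r x * Z + f x = u` for `Z`. At a solution the ratio equals `Z`, so the expression in
`slopeSet` is the true slope `r' Z + f'`. -/
lemma encard_crossings_eq_levelCount (h : IsSmoothStationaryGaussian U ρ P) {u x₀ : ℝ}
    {I B : Set ℝ} (hI : ∀ x ∈ I, 0 < regressionCoeff ρ x₀ x) (ω : Ω) :
    (({x | x ∈ I ∧ U x ω = u ∧ pathSlope U x ω ∈ B} : Set ℝ).encard : ℝ≥0∞) =
      levelCount (C1Path.ratio u (regressionCoeff ρ x₀))
        (C1Path.slopeSet u (regressionCoeff ρ x₀) I B) (U x₀ ω, h.residualPath x₀ ω) := by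
  rw [levelCount]
  congr 3
  ext x
  simp only [mem_ofPred_eq, C1Path.slopeSet]
  rw [and_assoc]
  refine and_congr_right fun hx => ?_
  have hr := hI x hx
  have hiff : U x ω = u ↔
      C1Path.ratio u (regressionCoeff ρ x₀) x (h.residualPath x₀ ω) = U x₀ ω := by
    rw [C1Path.ratio, div_eq_iff hr.ne', h.eq_regression x₀ x ω]
    constructor <;> intro hh <;> linarith
  rw [and_comm, hiff]
  refine and_congr_left fun hz => ?_
  rw [hz, h.pathSlope_eq_regression x₀, add_comm]

lemma measurable_encard_crossings (h : IsSmoothStationaryGaussian U ρ P) (u x₀ : ℝ)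
    {I B : Set ℝ} (hIm : MeasurableSet I) (hI : ∀ x ∈ I, 0 < regressionCoeff ρ x₀ x)
    (hBm : MeasurableSet B) (hB : B ⊆ Iio 0) :
    Measurable fun ω =>
      (({x | x ∈ I ∧ U x ω = u ∧ pathSlope U x ω ∈ B} : Set ℝ).encard : ℝ≥0∞) := by
  have hr := h.contDiff_regressionCoeff x₀
  have hO : IsOpen {x | regressionCoeff ρ x₀ x ≠ 0} :=
    isOpen_ne_fun hr.continuous continuous_const
  simp_rw [h.encard_crossings_eq_levelCount hI]
  refine Measurable.comp (g := levelCount (C1Path.ratio u (regressionCoeff ρ x₀))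
    (C1Path.slopeSet u (regressionCoeff ρ x₀) I B)) ?_
    ((h.measurable x₀).prodMk (h.measurable_residualPath x₀))
  exact measurable_levelCount hO (C1Path.measurable_ratio hr)
    (fun f x hx => C1Path.hasDerivAt_ratio hr f hx)
    (fun f => C1Path.continuousOn_ratioDeriv hr f) (C1Path.measurableSet_slopeSet hr hIm hBm)
    (fun p hp => (hI _ hp.1).ne') (fun p hp => C1Path.ratioDeriv_pos hI hB hp)

/-- Rice's formula with marks, on a set where the covariance with the value at `x₀` is positive. -/
theorem lintegral_encard_crossings_of_regressionCoeff_pos (h : IsSmoothStationaryGaussian U ρ P)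
    (hρ : 0 < ρ 0) (u x₀ : ℝ) {I B : Set ℝ} (hIm : MeasurableSet I)
    (hI : ∀ x ∈ I, 0 < regressionCoeff ρ x₀ x) (hBm : MeasurableSet B) (hB : B ⊆ Iio 0) :
    ∫⁻ ω, (({x | x ∈ I ∧ U x ω = u ∧ pathSlope U x ω ∈ B} : Set ℝ).encard : ℝ≥0∞) ∂P =
      volume I * (gaussianPDF 0 (ρ 0).toNNReal u *
        ∫⁻ y in B, ENNReal.ofReal (-y) ∂(gaussianReal 0 (Var[pathSlope U 0; P]).toNNReal)) := by
  have hP := h.centred.gaussian.isProbabilityMeasure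
  set r := regressionCoeff ρ x₀ with hr_def
  set v := (ρ 0).toNNReal with hv_def
  have hv : v ≠ 0 := (Real.toNNReal_pos.2 hρ).ne'
  have hr : ContDiff ℝ 1 r := h.contDiff_regressionCoeff x₀
  have hO : IsOpen {x | r x ≠ 0} := isOpen_ne_fun hr.continuous continuous_const
  have hT := h.measurable_residualPath x₀
  have hZ := h.measurable x₀
  have hE : MeasurableSet (C1Path.slopeSet u r I B) := C1Path.measurableSet_slopeSet hr hIm hBm
  have hpos : ∀ p ∈ C1Path.slopeSet u r I B, 0 < C1Path.ratioDeriv u r p.1 p.2 :=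
    fun p hp => C1Path.ratioDeriv_pos hI hB hp
  have hYm := C1Path.measurable_ratio (u := u) hr
  have hYm' := C1Path.measurable_ratioDeriv (u := u) hr
  have hφ := measurable_gaussianPDF 0 v
  have hN : Measurable (levelCount (C1Path.ratio u r) (C1Path.slopeSet u r I B)) :=
    measurable_levelCount hO hYm (fun f x hx => C1Path.hasDerivAt_ratio hr f hx)
      (fun f => C1Path.continuousOn_ratioDeriv hr f) hE (fun p hp => (hI _ hp.1).ne') hpos
  have hind := h.indepFun_residualPath hρ.ne' x₀
  have hprod := (indepFun_iff_map_prod_eq_prod_map_map hZ.aemeasurable hT.aemeasurable).1 hind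
  have hQ : IsProbabilityMeasure (P.map (h.residualPath x₀)) :=
    Measure.isProbabilityMeasure_map hT.aemeasurable
  let G : ℝ → ℝ≥0∞ := B.indicator fun c => ENNReal.ofReal (-c)
  have hG : Measurable G := (measurable_neg.ennreal_ofReal).indicator hBm
  let F : ℝ × C1Path → ℝ≥0∞ := (C1Path.slopeSet u r I B).indicator fun p =>
    ENNReal.ofReal (C1Path.ratioDeriv u r p.1 p.2) * gaussianPDF 0 v (C1Path.ratio u r p.1 p.2)
  have hF : Measurable F := (hYm'.ennreal_ofReal.mul (hφ.comp hYm)).indicator hE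
  -- The factor `(r x)⁻¹` in `ratioDeriv` cancels the `r x` produced by the substitution, so the
  -- intensity does not depend on `x`.
  have hFx : ∀ x ∈ I, ∫⁻ f, F (x, f) ∂(P.map (h.residualPath x₀)) =
      gaussianPDF 0 v u * ∫⁻ y in B, ENNReal.ofReal (-y)
        ∂(gaussianReal 0 (Var[pathSlope U 0; P]).toNNReal) := by
    intro x hx
    have hrx : 0 < r x := hI x hx
    have hFx : Measurable fun f => F (x, f) := hF.comp measurable_prodMk_left
    rw [lintegral_map hFx hT]
    have hA : Measurable fun ω => (h.residualPath x₀ ω).1 x := (C1Path.measurable_eval x).comp hT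
    have hB' : Measurable fun ω => deriv (h.residualPath x₀ ω).1 x :=
      (C1Path.measurable_deriv_eval x).comp hT
    have hi2 : IndepFun (U x₀)
        (fun ω => ((h.residualPath x₀ ω).1 x, deriv (h.residualPath x₀ ω).1 x)) P :=
      hind.comp measurable_id
        ((C1Path.measurable_eval x).prodMk (C1Path.measurable_deriv_eval x))
    have key := lintegral_gaussianPDF_mul hZ hA hB' hi2 hrx hv (h.map_eq x₀)
      (h.eq_regression x₀ x) (h.pathSlope_eq_regression x₀ x) (h.map_eq x)
      (h.indepFun_pathSlope x) u hG
    have hpt : ∀ ω, F (x, h.residualPath x₀ ω) = ENNReal.ofReal (r x)⁻¹ *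
        (gaussianPDF 0 v ((u - (h.residualPath x₀ ω).1 x) / r x) *
          G (deriv (h.residualPath x₀ ω).1 x +
            deriv r x * ((u - (h.residualPath x₀ ω).1 x) / r x))) := by
      intro ω
      by_cases hω : (x, h.residualPath x₀ ω) ∈ C1Path.slopeSet u r I B
      · have hω' : deriv (h.residualPath x₀ ω).1 x +
            deriv r x * ((u - (h.residualPath x₀ ω).1 x) / r x) ∈ B := hω.2
        simp only [F, G]
        rw [indicator_of_mem hω, indicator_of_mem hω', mul_left_comm,
          ← ENNReal.ofReal_mul (inv_nonneg.2 hrx.le), mul_comm]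
        congr 2
        simp only [C1Path.ratioDeriv, C1Path.ratio]
        rw [div_eq_mul_inv, mul_comm]
      · have hω' : deriv (h.residualPath x₀ ω).1 x +
            deriv r x * ((u - (h.residualPath x₀ ω).1 x) / r x) ∉ B := fun hb => hω ⟨hx, hb⟩
        simp only [F, G]
        rw [indicator_of_notMem hω, indicator_of_notMem hω', mul_zero, mul_zero]
    simp_rw [hpt]
    rw [lintegral_const_mul' _ _ ENNReal.ofReal_ne_top, key, ← mul_assoc, ← mul_assoc,
      ← ENNReal.ofReal_mul (inv_nonneg.2 hrx.le), inv_mul_cancel₀ hrx.ne', ENNReal.ofReal_one,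
      one_mul]
    congr 1
    rw [← h.map_pathSlope x, ← lintegral_indicator hBm, lintegral_map hG (h.measurable_pathSlope x)]
  simp_rw [h.encard_crossings_eq_levelCount hI]
  calc _ = ∫⁻ p, levelCount (C1Path.ratio u r) (C1Path.slopeSet u r I B) p
        ∂(P.map fun ω => (U x₀ ω, h.residualPath x₀ ω)) := (lintegral_map hN (hZ.prodMk hT)).symm
    _ = ∫⁻ f, ∫⁻ z, levelCount (C1Path.ratio u r) (C1Path.slopeSet u r I B) (z, f)
          ∂(gaussianReal 0 v) ∂(P.map (h.residualPath x₀)) := by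
        rw [hprod, h.map_eq x₀, lintegral_prod_symm _ hN.aemeasurable]
    _ = ∫⁻ f, (∫⁻ x in I, F (x, f)) ∂(P.map (h.residualPath x₀)) := by
        refine lintegral_congr fun f => ?_
        have hNf : Measurable fun z =>
            levelCount (C1Path.ratio u r) (C1Path.slopeSet u r I B) (z, f) :=
          hN.comp measurable_prodMk_right
        have hEf : MeasurableSet {x | (x, f) ∈ C1Path.slopeSet u r I B} :=
          measurable_prodMk_right hE
        rw [lintegral_gaussianReal hv _ hNf,
          lintegral_levelCount hO hYm (fun f x hx => C1Path.hasDerivAt_ratio hr f hx)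
            (fun f => C1Path.continuousOn_ratioDeriv hr f) hE (fun p hp => (hI _ hp.1).ne') hpos
            f hφ, ← lintegral_indicator hEf, ← lintegral_indicator hIm]
        congr 1
        ext x
        by_cases hx : (x, f) ∈ C1Path.slopeSet u r I B
        · rw [indicator_of_mem (by exact hx), indicator_of_mem hx.1]
          simp only [F]
          rw [indicator_of_mem hx]
        · rw [indicator_of_notMem (by exact hx)]
          by_cases hxI : x ∈ I
          · rw [indicator_of_mem hxI]
            simp only [F]
            rw [indicator_of_notMem hx]
          · rw [indicator_of_notMem hxI]
    _ = ∫⁻ x in I, ∫⁻ f, F (x, f) ∂(P.map (h.residualPath x₀)) := by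
        rw [lintegral_lintegral_swap]
        exact (hF.comp measurable_swap).aemeasurable
    _ = _ := by
        rw [setLIntegral_congr_fun hIm hFx, setLIntegral_const, mul_comm]

/-- The coefficient is continuous, equals `1` at lag zero and depends on `x - x₀` only; hence `η` is
uniform in `x₀`. -/
lemma exists_regressionCoeff_pos (h : IsSmoothStationaryGaussian U ρ P) (hρ : 0 < ρ 0) :
    ∃ η > 0, ∀ x₀, ∀ x ∈ Ico x₀ (x₀ + η), 0 < regressionCoeff ρ x₀ x := by
  have hc := (h.contDiff_regressionCoeff 0).continuous.tendsto 0
  have h0 : 0 < regressionCoeff ρ 0 0 := by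
    simp only [regressionCoeff, sub_zero]
    exact div_pos hρ hρ
  obtain ⟨η, hη, hball⟩ := Metric.eventually_nhds_iff.1 (hc.eventually (lt_mem_nhds h0))
  refine ⟨η, hη, fun x₀ x hx => ?_⟩
  have := hball (y := x - x₀) (by
    rw [Real.dist_eq, sub_zero, abs_of_nonneg (by linarith [hx.1])]
    linarith [hx.2])
  simpa [regressionCoeff] using this

/-- Rice's formula with marks: the expected number of crossings of the level `u` in `I` with
slope in `B ⊆ (-∞, 0)`. -/
theorem lintegral_encard_crossings (h : IsSmoothStationaryGaussian U ρ P)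
    (hρ : 0 < ρ 0) (u : ℝ) {I B : Set ℝ} (hIm : MeasurableSet I)
    (hBm : MeasurableSet B) (hB : B ⊆ Iio 0) :
    ∫⁻ ω, (({x | x ∈ I ∧ U x ω = u ∧ pathSlope U x ω ∈ B} : Set ℝ).encard : ℝ≥0∞) ∂P =
      volume I * (gaussianPDF 0 (ρ 0).toNNReal u *
        ∫⁻ y in B, ENNReal.ofReal (-y) ∂(gaussianReal 0 (Var[pathSlope U 0; P]).toNNReal)) := by
  obtain ⟨η, hη, hr⟩ := h.exists_regressionCoeff_pos hρ
  -- Each piece is regressed on the value at its own left endpoint `k • η`.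
  let J : ℤ → Set ℝ := fun k => I ∩ Ico (k • η) ((k + 1) • η)
  have hJm : ∀ k, MeasurableSet (J k) := fun k => hIm.inter measurableSet_Ico
  have hJd : Pairwise (Function.onFun Disjoint J) := fun i j hij =>
    ((pairwise_disjoint_Ico_zsmul η) hij).mono inter_subset_right inter_subset_right
  have hJU : ⋃ k, J k = I := by
    rw [← inter_iUnion, iUnion_Ico_zsmul hη, inter_univ]
  have hJr : ∀ k, ∀ x ∈ J k, 0 < regressionCoeff ρ (k • η) x := by
    intro k x hx
    refine hr _ x ⟨hx.2.1, ?_⟩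
    have := hx.2.2
    rwa [add_smul, one_smul] at this
  have hsum : ∀ ω, (({x | x ∈ I ∧ U x ω = u ∧ pathSlope U x ω ∈ B} : Set ℝ).encard : ℝ≥0∞) =
      ∑' k, (({x | x ∈ J k ∧ U x ω = u ∧ pathSlope U x ω ∈ B} : Set ℝ).encard : ℝ≥0∞) := by
    intro ω
    have hm : MeasurableSet {x | U x ω = u ∧ pathSlope U x ω ∈ B} :=
      ((h.contDiff ω).continuous.measurable (measurableSet_singleton u)).inter
        ((h.continuous_pathSlope ω).measurable hBm)
    have hset : ∀ K : Set ℝ, MeasurableSet K →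
        (({x | x ∈ K ∧ U x ω = u ∧ pathSlope U x ω ∈ B} : Set ℝ).encard : ℝ≥0∞) =
        Measure.count (K ∩ {x | U x ω = u ∧ pathSlope U x ω ∈ B}) := fun K hK =>
      (Measure.count_apply (hK.inter hm)).symm
    rw [hset I hIm, ← hJU, iUnion_inter, measure_iUnion]
    · exact tsum_congr fun k => (hset _ (hJm k)).symm
    · exact fun i j hij => (hJd hij).mono inter_subset_left inter_subset_left
    · exact fun k => (hJm k).inter hm
  simp_rw [hsum]
  rw [lintegral_tsum fun k => (h.measurable_encard_crossings u (k • η) (hJm k) (hJr k) hBm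
    hB).aemeasurable]
  simp_rw [fun k => h.lintegral_encard_crossings_of_regressionCoeff_pos hρ u (k • η) (hJm k)
    (hJr k) hBm hB]
  rw [ENNReal.tsum_mul_right, ← measure_iUnion hJd hJm, hJU]

end IsSmoothStationaryGaussian

/-! ### The negative Rayleigh law as a size-biased Gaussian -/

lemma lintegral_negRayleigh_density :
    ∫⁻ r : ℝ, ENNReal.ofReal (if r < 0 then -r * Real.exp (-r ^ 2 / 2) else 0) = 1 := by
  have hint : Integrable fun r : ℝ => -r * Real.exp (-r ^ 2 / 2) := by
    refine (integrable_mul_exp_neg_mul_sq (b := 1 / 2) (by norm_num)).neg.congr ?_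
    refine Filter.Eventually.of_forall fun r => ?_
    simp only [Pi.neg_apply]
    ring_nf
  have hd : ∀ r ∈ Iic (0 : ℝ), HasDerivAt (fun r : ℝ => Real.exp (-r ^ 2 / 2))
      (-r * Real.exp (-r ^ 2 / 2)) r := by
    intro r _
    have h1 : HasDerivAt (fun r : ℝ => -r ^ 2 / 2) (-r) r := by
      refine (((hasDerivAt_pow 2 r).neg).div_const 2).congr_deriv ?_
      simp
      ring
    exact h1.exp.congr_deriv (mul_comm _ _)
  have hlim : Filter.Tendsto (fun r : ℝ => Real.exp (-r ^ 2 / 2)) Filter.atBot (nhds 0) := by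
    refine Real.tendsto_exp_atBot.comp ?_
    have h2 : Filter.Tendsto (fun r : ℝ => r ^ 2) Filter.atBot Filter.atTop :=
      ((Filter.tendsto_pow_atTop two_ne_zero).comp Filter.tendsto_abs_atBot_atTop).congr fun r =>
        sq_abs r
    refine (Filter.tendsto_neg_atTop_atBot.comp
      (h2.atTop_div_const (by norm_num : (0 : ℝ) < 2))).congr fun r => ?_
    simp only [Function.comp]
    ring
  have h := integral_Iic_of_hasDerivAt_of_tendsto' hd hint.integrableOn hlim
  have hset : ∀ r : ℝ, ENNReal.ofReal (if r < 0 then -r * Real.exp (-r ^ 2 / 2) else 0) =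
      (Iio (0 : ℝ)).indicator (fun r => ENNReal.ofReal (-r * Real.exp (-r ^ 2 / 2))) r := by
    intro r
    by_cases hr : r < 0
    · rw [if_pos hr, indicator_of_mem (by exact hr)]
    · rw [if_neg hr, indicator_of_notMem (by exact hr), ENNReal.ofReal_zero]
  simp_rw [hset]
  rw [lintegral_indicator measurableSet_Iio, setLIntegral_congr Iio_ae_eq_Iic,
    ← ofReal_integral_eq_lintegral_ofReal hint.integrableOn, h]
  · simp
  · refine (ae_restrict_iff' measurableSet_Iic).2 (Filter.Eventually.of_forall fun r hr => ?_)
    exact mul_nonneg (neg_nonneg.2 hr) (Real.exp_pos _).le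

lemma isProbabilityMeasure_negRayleigh : IsProbabilityMeasure negRayleigh := by
  refine ⟨?_⟩
  rw [negRayleigh, withDensity_apply _ MeasurableSet.univ, Measure.restrict_univ]
  exact lintegral_negRayleigh_density

/-- Size-biasing the negative part of a centred Gaussian variable gives the negative Rayleigh
law. -/
theorem setLIntegral_neg_gaussianReal {l : ℝ} (hl : 0 < l) {B : Set ℝ} (hB : MeasurableSet B) :
    ∫⁻ y in Iio 0 ∩ B, ENNReal.ofReal (-y) ∂(gaussianReal 0 l.toNNReal) =
      ENNReal.ofReal (√l / √(2 * Real.pi)) * negRayleigh {r | √l * r ∈ B} := by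
  have hs : 0 < √l := Real.sqrt_pos.2 hl
  have hv : l.toNNReal ≠ 0 := (Real.toNNReal_pos.2 hl).ne'
  have hm : MeasurableSet (Iio 0 ∩ B) := measurableSet_Iio.inter hB
  have hmB : MeasurableSet {r | √l * r ∈ B} := measurable_const_mul _ hB
  -- Substitute `y = √l * r`: one `√l` from `dy` cancels the normalization of the density, and the
  -- one from `-y` survives in `√l / √(2π)`.
  rw [← lintegral_indicator hm, lintegral_gaussianReal hv _
    ((measurable_neg.ennreal_ofReal).indicator hm), negRayleigh, withDensity_apply _ hmB,
    ← lintegral_indicator hmB, ← lintegral_const_mul' _ _ ENNReal.ofReal_ne_top,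
    lintegral_eq_ofReal_mul_lintegral_affine hs 0, ← lintegral_const_mul' _ _ ENNReal.ofReal_ne_top]
  congr 1
  ext r
  rw [add_zero]
  by_cases hB' : √l * r ∈ B
  · rw [indicator_of_mem (s := {r | √l * r ∈ B}) hB']
    by_cases hr : r < 0
    · have hneg : √l * r < 0 := mul_neg_of_pos_of_neg hs hr
      rw [indicator_of_mem (s := Iio 0 ∩ B) ⟨hneg, hB'⟩, if_pos hr, gaussianPDF,
        ← ENNReal.ofReal_mul (gaussianPDFReal_nonneg _ _ _), ← ENNReal.ofReal_mul hs.le,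
        ← ENNReal.ofReal_mul (by positivity)]
      congr 1
      rw [gaussianPDFReal, Real.coe_toNNReal _ hl.le, Real.sqrt_mul (by positivity)]
      have he : -(√l * r - 0) ^ 2 / (2 * l) = -r ^ 2 / 2 := by
        rw [sub_zero, mul_pow, Real.sq_sqrt hl.le]
        field_simp
      rw [he]
      field_simp
    · have hneg : √l * r ∉ Iio (0 : ℝ) := not_lt.2 (mul_nonneg hs.le (not_lt.1 hr))
      rw [indicator_of_notMem (s := Iio 0 ∩ B) fun hh => hneg hh.1, if_neg hr]
      simp
  · rw [indicator_of_notMem (s := Iio 0 ∩ B) fun hh => hB' hh.2,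
      indicator_of_notMem (s := {r | √l * r ∈ B}) hB']
    simp

/-- Links the conditional expectations of the negative part to the mark integral in Rice's formula.
-/
lemma lintegral_negativePart_gaussianPDFReal {v : ℝ≥0} (hv : v ≠ 0) {B : Set ℝ}
    (hB : MeasurableSet B) :
    ∫⁻ y, ENNReal.ofReal (negativePart y * B.indicator 1 y * gaussianPDFReal 0 v y) =
      ∫⁻ y in Iio 0 ∩ B, ENNReal.ofReal (-y) ∂(gaussianReal 0 v) := by
  have hm : MeasurableSet (Iio 0 ∩ B) := measurableSet_Iio.inter hB
  rw [← lintegral_indicator hm, lintegral_gaussianReal hv _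
    ((measurable_neg.ennreal_ofReal).indicator hm)]
  congr 1
  ext y
  by_cases hy : y ∈ B
  · by_cases hy0 : y < 0
    · have : negativePart y = -y := max_eq_left (by linarith)
      rw [indicator_of_mem hy, indicator_of_mem (s := Iio 0 ∩ B) ⟨hy0, hy⟩, this, Pi.one_apply, mul_one,
        ENNReal.ofReal_mul (by linarith), mul_comm]
      rfl
    · have : negativePart y = 0 := max_eq_right (by linarith)
      rw [indicator_of_notMem (s := Iio 0 ∩ B) fun hh => hy0 hh.1, this]
      simp
  · rw [indicator_of_notMem hy, indicator_of_notMem (s := Iio 0 ∩ B) fun hh => hy hh.2]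
    simp

lemma measurable_negativePart : Measurable negativePart := measurable_neg.max measurable_const

lemma integrable_negativePart_gaussianPDFReal {l : ℝ} (hl : 0 < l) {B : Set ℝ}
    (hB : MeasurableSet B) :
    Integrable fun y => negativePart y * B.indicator 1 y * gaussianPDFReal 0 l.toNNReal y := by
  have hv : l.toNNReal ≠ 0 := (Real.toNNReal_pos.2 hl).ne'
  refine (lintegral_ofReal_ne_top_iff_integrable ?_ ?_).1 ?_
  · exact ((measurable_negativePart.mul (measurable_one.indicator hB)).mul
      (measurable_gaussianPDFReal _ _)).aestronglyMeasurable
  · refine Filter.Eventually.of_forall fun y => ?_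
    exact mul_nonneg (mul_nonneg (le_max_right _ _) (indicator_nonneg (fun _ _ => zero_le_one) _))
      (gaussianPDFReal_nonneg _ _ _)
  · have := isProbabilityMeasure_negRayleigh
    rw [lintegral_negativePart_gaussianPDFReal hv hB, setLIntegral_neg_gaussianReal hl hB]
    exact ENNReal.mul_ne_top ENNReal.ofReal_ne_top (measure_ne_top _ _)

lemma integral_negativePart_gaussianPDFReal {l : ℝ} (hl : 0 < l) {B : Set ℝ}
    (hB : MeasurableSet B) :
    ∫ y, negativePart y * B.indicator 1 y * gaussianPDFReal 0 l.toNNReal y =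
      √l / √(2 * Real.pi) * negRayleigh.real {r | √l * r ∈ B} := by
  have hv : l.toNNReal ≠ 0 := (Real.toNNReal_pos.2 hl).ne'
  rw [integral_eq_lintegral_of_nonneg_ae _
    (integrable_negativePart_gaussianPDFReal hl hB).aestronglyMeasurable,
    lintegral_negativePart_gaussianPDFReal hv hB, setLIntegral_neg_gaussianReal hl hB,
    ENNReal.toReal_mul, ENNReal.toReal_ofReal (by positivity)]
  · rfl
  · refine Filter.Eventually.of_forall fun y => ?_
    exact mul_nonneg (mul_nonneg (le_max_right _ _) (indicator_nonneg (fun _ _ => zero_le_one) _))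
      (gaussianPDFReal_nonneg _ _ _)

/-! ### The second spectral moment -/

lemma tendsto_one_sub_cos_div_sq (a : ℝ) :
    Filter.Tendsto (fun t : ℝ => 2 * (1 - Real.cos (a * t)) / t ^ 2) (nhdsWithin 0 {0}ᶜ)
      (nhds (a ^ 2)) := by
  have hd : HasDerivAt (fun t : ℝ => Real.sin (a / 2 * t)) (a / 2) 0 := by
    have h1 : HasDerivAt (fun t : ℝ => a / 2 * t) (a / 2) 0 := by
      simpa using (hasDerivAt_id (0 : ℝ)).const_mul (a / 2)
    simpa using h1.sin
  have h2 := ((hasDerivAt_iff_tendsto_slope_zero.1 hd).pow 2).const_mul 4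
  refine (h2.congr fun t => ?_).trans_eq (by congr 1; ring)
  have hc : Real.cos (a * t) = 1 - 2 * Real.sin (a / 2 * t) ^ 2 := by
    have h3 : a * t = 2 * (a / 2 * t) := by ring
    rw [h3, Real.cos_two_mul]
    linarith [Real.sin_sq_add_cos_sq (a / 2 * t)]
  rw [hc]
  simp only [zero_add, mul_zero, Real.sin_zero, sub_zero, smul_eq_mul]
  rw [mul_pow, inv_pow]
  ring

lemma one_sub_cos_div_sq_le (a t : ℝ) : 2 * (1 - Real.cos (a * t)) / t ^ 2 ≤ a ^ 2 := by
  rcases eq_or_ne t 0 with rfl | ht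
  · simp only [ne_eq, OfNat.ofNat_ne_zero, not_false_eq_true, zero_pow, div_zero]
    positivity
  · rw [div_le_iff₀ (by positivity)]
    have := Real.one_sub_sq_div_two_le_cos (x := a * t)
    nlinarith

/-- If `(2 ∫ (1 - cos (a t)) S) / t²` has a finite limit at zero, the second moment of the
spectral density `S ≥ 0` is finite and is this limit. -/
theorem integrable_sq_mul_of_tendsto {α : Type*} [MeasurableSpace α] {μ : Measure α} {a S : α → ℝ}
    {L : ℝ} (ha : Measurable a) (hS : Integrable S μ) (hS0 : 0 ≤ᵐ[μ] S)
    (h : Filter.Tendsto (fun t : ℝ => ∫ p, 2 * (1 - Real.cos (a p * t)) / t ^ 2 * S p ∂μ)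
      (nhdsWithin 0 {0}ᶜ) (nhds L)) :
    Integrable (fun p => a p ^ 2 * S p) μ ∧ ∫ p, a p ^ 2 * S p ∂μ = L := by
  have hlim : ∀ p, Filter.Tendsto (fun t : ℝ => 2 * (1 - Real.cos (a p * t)) / t ^ 2 * S p)
      (nhdsWithin 0 {0}ᶜ) (nhds (a p ^ 2 * S p)) := fun p =>
    (tendsto_one_sub_cos_div_sq (a p)).mul_const (S p)
  have hq0 : ∀ p (t : ℝ), 0 ≤ 2 * (1 - Real.cos (a p * t)) / t ^ 2 := fun p t =>
    div_nonneg (by linarith [Real.cos_le_one (a p * t)]) (sq_nonneg t)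
  have hqm : ∀ t : ℝ, AEStronglyMeasurable
      (fun p => 2 * (1 - Real.cos (a p * t)) / t ^ 2 * S p) μ := fun t =>
    (by fun_prop : Measurable fun p => 2 * (1 - Real.cos (a p * t)) / t ^ 2).aestronglyMeasurable.mul
      hS.aestronglyMeasurable
  have hqi : ∀ t : ℝ, Integrable (fun p => 2 * (1 - Real.cos (a p * t)) / t ^ 2 * S p) μ := by
    intro t
    refine hS.bdd_mul (c := 4 / t ^ 2) (Measurable.aestronglyMeasurable (by fun_prop)) ?_
    refine Filter.Eventually.of_forall fun p => ?_
    rw [Real.norm_of_nonneg (hq0 p t)]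
    gcongr
    linarith [Real.neg_one_le_cos (a p * t)]
  have hint : Integrable (fun p => a p ^ 2 * S p) μ := by
    refine (lintegral_ofReal_ne_top_iff_integrable
      ((ha.pow_const 2).aestronglyMeasurable.mul hS.aestronglyMeasurable) ?_).1 ?_
    · filter_upwards [hS0] with p hp
      exact mul_nonneg (sq_nonneg _) hp
    · refine ne_top_of_le_ne_top (ENNReal.ofReal_ne_top (r := L)) ?_
      -- Fatou's lemma: the limit `L` bounds the second moment, which is therefore finite and can
      -- dominate the quotients below.
      calc _ = ∫⁻ p, Filter.liminf (fun t : ℝ =>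
              ENNReal.ofReal (2 * (1 - Real.cos (a p * t)) / t ^ 2 * S p))
              (nhdsWithin 0 {0}ᶜ) ∂μ := by
            refine lintegral_congr fun p => ?_
            exact (((ENNReal.continuous_ofReal.tendsto _).comp (hlim p)).liminf_eq).symm
        _ ≤ _ := lintegral_liminf_le' fun t => (hqm t).aemeasurable.ennreal_ofReal
        _ = ENNReal.ofReal L := by
            refine Filter.Tendsto.liminf_eq ?_
            refine ((ENNReal.continuous_ofReal.tendsto _).comp h).congr fun t => ?_
            refine ofReal_integral_eq_lintegral_ofReal (hqi t) ?_
            filter_upwards [hS0] with p hp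
            exact mul_nonneg (hq0 p t) hp
  refine ⟨hint, tendsto_nhds_unique ?_ h⟩
  refine tendsto_integral_filter_of_dominated_convergence (fun p => a p ^ 2 * S p)
    (Filter.Eventually.of_forall hqm) (Filter.Eventually.of_forall fun t => ?_) hint
    (Filter.Eventually.of_forall hlim)
  filter_upwards [hS0] with p hp
  rw [Real.norm_of_nonneg (mul_nonneg (hq0 p t) hp)]
  exact mul_le_mul_of_nonneg_right (one_sub_cos_div_sq_le _ _) hp

/-! ### Reduction to a centred process with smooth paths -/

section

variable {Ω : Type*} [MeasurableSpace Ω] {P : Measure Ω}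

/-- A process with almost surely continuously differentiable paths is indistinguishable from a
measurable one all of whose paths are continuously differentiable. -/
lemma exists_measurable_contDiff_version {W : ℝ → Ω → ℝ} (hW : ∀ x, AEMeasurable (W x) P)
    (hC1 : ∀ᵐ ω ∂P, ContDiff ℝ 1 (fun x => W x ω)) :
    ∃ V : ℝ → Ω → ℝ, (∀ ω, ContDiff ℝ 1 (fun x => V x ω)) ∧ (∀ x, Measurable (V x)) ∧
      ∀ᵐ ω ∂P, ∀ x, V x ω = W x ω := by
  -- Countably many measurable versions suffice: off a measurable set of full measure the path is
  -- replaced by zero, and the other times are limits of rational ones.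
  have hae : ∀ᵐ ω ∂P, ContDiff ℝ 1 (fun x => W x ω) ∧ ∀ q : ℚ, W q ω = (hW q).mk (W q) ω :=
    hC1.and (ae_all_iff.2 fun q => (hW q).ae_eq_mk)
  obtain ⟨A, hA, hAm, hAp⟩ := hae.exists_measurable_mem
  have hV : ∀ ω, ContDiff ℝ 1 (fun x => A.indicator (W x) ω) := by
    intro ω
    by_cases hω : ω ∈ A
    · simpa only [indicator_of_mem hω] using (hAp ω hω).1
    · simpa only [indicator_of_notMem hω] using contDiff_const
  have hVq : ∀ q : ℚ, Measurable (A.indicator (W q)) := by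
    intro q
    have : A.indicator (W q) = A.indicator ((hW q).mk (W q)) :=
      indicator_congr fun ω hω => (hAp ω hω).2 q
    rw [this]
    exact (hW q).measurable_mk.indicator hAm
  refine ⟨fun x => A.indicator (W x), hV, fun x => ?_, ?_⟩
  · have : (Filter.comap ((↑) : ℚ → ℝ) (nhds x)).NeBot :=
      Rat.isDenseEmbedding_coe_real.isDenseInducing.comap_nhds_neBot x
    refine measurable_of_tendsto_metrizable' (Filter.comap ((↑) : ℚ → ℝ) (nhds x))
      (f := fun q : ℚ => A.indicator (W q)) hVq (tendsto_pi_nhds.2 fun ω => ?_)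
    exact ((hV ω).continuous.tendsto x).comp Filter.tendsto_comap
  · filter_upwards [hA] with ω hω x
    rw [indicator_of_mem hω]

lemma ProbabilityTheory.IsGaussianProcess.sub_const {T : Type*} {X : T → Ω → ℝ}
    (hX : IsGaussianProcess X P) (c : ℝ) : IsGaussianProcess (fun t ω => X t ω - c) P where
  hasGaussianLaw I := by
    have hI := hX.hasGaussianLaw I
    have := hI.isGaussian_map
    have hm : P.map (fun ω => I.restrict fun t => X t ω - c) =
        (P.map fun ω => I.restrict (X · ω)).map fun x => x - fun _ => c := by
      rw [AEMeasurable.map_map_of_aemeasurable (by fun_prop) hI.aemeasurable]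
      rfl
    refine ⟨?_⟩
    rw [hm]
    infer_instance

lemma covariance_congr_ae {X X' Y Y' : Ω → ℝ} (hX : X =ᵐ[P] X') (hY : Y =ᵐ[P] Y') :
    cov[X, Y; P] = cov[X', Y'; P] := by
  rw [covariance, covariance, integral_congr_ae hX, integral_congr_ae hY]
  refine integral_congr_ae ?_
  filter_upwards [hX, hY] with ω h1 h2
  rw [h1, h2]

lemma integral_eq_of_stationary {W : ℝ → Ω → ℝ} (hW : ∀ x, AEMeasurable (W x) P)
    (hStat : IsStationaryProcess W P) (x : ℝ) : P[W x] = P[W 0] := by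
  have h := congrArg (fun μ : Measure (Fin 1 → ℝ) => ∫ f, f 0 ∂μ) (hStat x 1 fun _ => 0)
  simp only [zero_add] at h
  rw [integral_map (aemeasurable_pi_lambda _ fun _ => hW x)
    (measurable_pi_apply 0).aestronglyMeasurable,
    integral_map (aemeasurable_pi_lambda _ fun _ => hW 0)
    (measurable_pi_apply 0).aestronglyMeasurable] at h
  exact h

lemma covariance_eq_of_stationary {W : ℝ → Ω → ℝ} (hW : ∀ x, AEMeasurable (W x) P)
    (hStat : IsStationaryProcess W P) (x y : ℝ) : cov[W x, W y; P] = cov[W 0, W (y - x); P] := by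
  have h := congrArg (fun μ : Measure (Fin 2 → ℝ) => cov[fun f => f 0, fun f => f 1; μ])
    (hStat x 2 ![0, y - x])
  have h0 : ∀ z : ℝ, AEMeasurable (fun ω (i : Fin 2) => W ((![0, y - x] : Fin 2 → ℝ) i + z) ω) P :=
    fun z => aemeasurable_pi_lambda _ fun i => hW _
  have h1 : AEMeasurable (fun ω (i : Fin 2) => W ((![0, y - x] : Fin 2 → ℝ) i) ω) P :=
    aemeasurable_pi_lambda _ fun i => hW _
  rw [covariance_map (measurable_pi_apply 0).aestronglyMeasurable
    (measurable_pi_apply 1).aestronglyMeasurable (h0 x),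
    covariance_map (measurable_pi_apply 0).aestronglyMeasurable
    (measurable_pi_apply 1).aestronglyMeasurable h1] at h
  simpa [Function.comp_def] using h

/-- The centred and everywhere smooth version of a stationary Gaussian process. -/
theorem exists_isSmoothStationaryGaussian {W : ℝ → Ω → ℝ} (hGauss : IsGaussianProcess W P)
    (hStat : IsStationaryProcess W P) (hC1 : ∀ᵐ ω ∂P, ContDiff ℝ 1 (fun x => W x ω)) :
    ∃ U : ℝ → Ω → ℝ, IsSmoothStationaryGaussian U (fun t => cov[W 0, W t; P]) P ∧
      ∀ᵐ ω ∂P, (∀ x, U x ω = W x ω - P[W 0]) ∧ ∀ x, pathSlope U x ω = pathSlope W x ω := by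
  have hP := hGauss.isProbabilityMeasure
  have hW := hGauss.aemeasurable
  obtain ⟨V, hV, hVm, hVW⟩ := exists_measurable_contDiff_version hW hC1
  have hVx : ∀ x, V x =ᵐ[P] W x := fun x => hVW.mono fun ω hω => hω x
  have hVg : IsGaussianProcess V P := hGauss.congr fun x => (hVx x).symm
  have hVi : ∀ x, Integrable (V x) P := fun x => (hVg.hasGaussianLaw_eval x).integrable
  refine ⟨fun x ω => V x ω - P[W 0], ⟨fun ω => (hV ω).sub contDiff_const,
    fun x => (hVm x).sub_const _, ⟨hVg.sub_const _, fun x => ?_⟩, fun x y => ?_⟩, ?_⟩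
  · rw [integral_sub (hVi x) (integrable_const _), integral_congr_ae (hVx x),
      integral_eq_of_stationary hW hStat x]
    simp
  · rw [covariance_sub_const_left (hVi x), covariance_sub_const_right (hVi y),
      ← covariance_eq_of_stationary hW hStat]
    exact covariance_congr_ae (hVx x) (hVx y)
  · filter_upwards [hVW] with ω hω
    have hfun : (fun x => V x ω) = fun x => W x ω := funext hω
    refine ⟨fun x => by rw [hω], fun x => ?_⟩
    simp only [pathSlope, deriv_sub_const, hfun]

end

/-! ### The Palm distribution of the slope at wave centres -/

theorem theorem6p1 {Ω : Type*} [MeasurableSpace Ω] (P : Measure Ω) [IsProbabilityMeasure P]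
    (W : ℝ → Ω → ℝ)
    (hGauss : IsGaussianProcess W P)
    (hStat : IsStationaryProcess W P)
    (hC1 : ∀ᵐ ω ∂P, ContDiff ℝ 1 (fun x => W x ω))
    (hNondeg : 0 < variance (pathSlope W 0) P) :
    -- the intensity of wave centres is positive and finite, so the Palm distribution makes sense
    expectedCentres P W ≠ 0 ∧ expectedCentres P W ≠ ∞ ∧
    -- the ratio of Rice-type conditional expectations
    (∃ (fYZ : ℝ × ℝ → ℝ) (fZ : ℝ → ℝ),
      IsContinuousDensity fYZ (P.map (fun ω => (pathSlope W 0 ω, W 0 ω))) ∧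
      IsContinuousDensity fZ (P.map (W 0)) ∧
      0 < fZ 0 ∧
      Integrable (fun y => negativePart y * (fYZ (y, 0) / fZ 0)) ∧
      0 < condExpGivenValue fYZ fZ negativePart 0 ∧
      ∀ w : ℝ, palmSlopeCDF P W w =
        (condExpGivenValue fYZ fZ (fun y => negativePart y * (Iic w).indicator 1 y) 0 * fZ 0) /
          (condExpGivenValue fYZ fZ negativePart 0 * fZ 0)) ∧
    -- the explicit form, with `λ₂₀ = Var W_x(0)`
    IsProbabilityMeasure negRayleigh ∧
    (∀ w : ℝ, palmSlopeCDF P W w =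
      negRayleigh.real {r | √(variance (pathSlope W 0) P) * r ≤ w}) ∧
    -- `λ₂₀` is the second spatial spectral moment whenever there is a directional spectral density
    (∀ (S : ℝ × ℝ → ℝ) (κ : ℝ → ℝ), IsDirectionalSpectrum P W S κ →
      IntegrableOn (fun p : ℝ × ℝ => (κ p.1 * Real.cos p.2) ^ 2 * S p) spectralDomain ∧
      spectralMoment S κ 2 0 = variance (pathSlope W 0) P) := by
  have hR := isProbabilityMeasure_negRayleigh
  obtain ⟨U, hU, hUW⟩ := exists_isSmoothStationaryGaussian hGauss hStat hC1
  set ρ : ℝ → ℝ := fun t => cov[W 0, W t; P] with hρdef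
  set m : ℝ := P[W 0] with hm
  set l : ℝ := Var[pathSlope W 0; P] with hldef
  have hslope : pathSlope U 0 =ᵐ[P] pathSlope W 0 := hUW.mono fun ω hω => hω.2 0
  have hl : Var[pathSlope U 0; P] = l := variance_congr hslope
  have hρ : 0 < ρ 0 := hU.pos (by rwa [hl])
  have hv : (ρ 0).toNNReal ≠ 0 := (Real.toNNReal_pos.2 hρ).ne'
  have hvl : l.toNNReal ≠ 0 := (Real.toNNReal_pos.2 hNondeg).ne'
  -- the expected numbers of crossings
  have hcount : ∀ B : Set ℝ, MeasurableSet B →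
      ∫⁻ ω, (({x | x ∈ waveCentres W ω ∧ pathSlope W x ω ∈ B} : Set ℝ).encard : ℝ≥0∞) ∂P =
      gaussianPDF 0 (ρ 0).toNNReal (-m) * ENNReal.ofReal (√l / √(2 * Real.pi)) *
        negRayleigh {r | √l * r ∈ B} := by
    intro B hB
    rw [mul_assoc, ← setLIntegral_neg_gaussianReal hNondeg hB, ← hl]
    -- The mean `m` of `W` may be nonzero, so zeros of `W` are crossings of `-m` by `U`.
    have hrice := hU.lintegral_encard_crossings hρ (-m) (measurableSet_Icc (a := (0 : ℝ)) (b := 1))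
      (measurableSet_Iio.inter hB) inter_subset_left
    rw [Real.volume_Icc, sub_zero, ENNReal.ofReal_one, one_mul] at hrice
    rw [← hrice]
    refine lintegral_congr_ae ?_
    filter_upwards [hUW] with ω hω
    congr 3
    ext x
    simp only [waveCentres, mem_ofPred_eq, hω.1, hω.2, mem_inter_iff, mem_Iio]
    have : W x ω - m = -m ↔ W x ω = 0 := by
      constructor <;> intro hh <;> linarith
    rw [this]
    tauto
  have hle : ∀ w, expectedCentresSlopeLE P W w =
      gaussianPDF 0 (ρ 0).toNNReal (-m) * ENNReal.ofReal (√l / √(2 * Real.pi)) *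
        negRayleigh {r | √l * r ≤ w} := fun w => hcount (Iic w) measurableSet_Iic
  have htot : expectedCentres P W =
      gaussianPDF 0 (ρ 0).toNNReal (-m) * ENNReal.ofReal (√l / √(2 * Real.pi)) := by
    have h := hcount univ MeasurableSet.univ
    simp only [mem_univ, and_true, ofPred_mem_eq, ofPred_true, measure_univ, mul_one] at h
    exact h
  have hs : 0 < √l / √(2 * Real.pi) :=
    div_pos (Real.sqrt_pos.2 hNondeg) (Real.sqrt_pos.2 (by positivity))
  have hc0 : gaussianPDF 0 (ρ 0).toNNReal (-m) * ENNReal.ofReal (√l / √(2 * Real.pi)) ≠ 0 :=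
    mul_ne_zero (gaussianPDF_pos _ hv _).ne' (ENNReal.ofReal_pos.2 hs).ne'
  have hctop : gaussianPDF 0 (ρ 0).toNNReal (-m) * ENNReal.ofReal (√l / √(2 * Real.pi)) ≠ ∞ :=
    ENNReal.mul_ne_top gaussianPDF_ne_top ENNReal.ofReal_ne_top
  have hpalm : ∀ w, palmSlopeCDF P W w = negRayleigh.real {r | √l * r ≤ w} := by
    intro w
    rw [palmSlopeCDF, hle, htot, mul_comm, ENNReal.mul_div_cancel_right hc0 hctop]
    rfl
  refine ⟨htot ▸ hc0, htot ▸ hctop, ?_, hR, hpalm, ?_⟩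
  · -- the densities
    have hUm : ∀ᵐ ω ∂P, W 0 ω = U 0 ω + m := hUW.mono fun ω hω => by rw [hω.1]; ring
    have hlawW : P.map (W 0) = gaussianReal m (ρ 0).toNNReal := by
      rw [Measure.map_congr hUm, ← zero_add m, ← gaussianReal_map_add_const, zero_add,
        ← hU.map_eq 0, Measure.map_map (measurable_add_const m) (hU.measurable 0)]
      rfl
    have hlawS : P.map (pathSlope W 0) = gaussianReal 0 l.toNNReal := by
      rw [← Measure.map_congr hslope, hU.map_pathSlope, hl]
    have hind : IndepFun (pathSlope W 0) (W 0) P :=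
      ((hU.indepFun_pathSlope 0).comp measurable_id (measurable_add_const m)).congr hslope
        (hUm.mono fun ω hω => hω.symm)
    -- By independence the joint density is a product, so conditioning on `W 0 = 0` leaves the
    -- Gaussian density of the slope.
    have hcond : ∀ g : ℝ → ℝ, condExpGivenValue
        (fun p => gaussianPDFReal 0 l.toNNReal p.1 * gaussianPDFReal m (ρ 0).toNNReal p.2)
        (gaussianPDFReal m (ρ 0).toNNReal) g 0 = ∫ y, g y * gaussianPDFReal 0 l.toNNReal y := by
      intro g
      rw [condExpGivenValue]
      congr 1
      ext y
      rw [mul_div_cancel_right₀ _ (gaussianPDFReal_pos _ _ _ hv).ne']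
    have hone : ∀ y, negativePart y = negativePart y * (univ : Set ℝ).indicator 1 y := by
      intro y
      simp
    have hcondtot : condExpGivenValue
        (fun p => gaussianPDFReal 0 l.toNNReal p.1 * gaussianPDFReal m (ρ 0).toNNReal p.2)
        (gaussianPDFReal m (ρ 0).toNNReal) negativePart 0 = √l / √(2 * Real.pi) := by
      rw [hcond]
      simp_rw [fun y => congrArg (· * gaussianPDFReal 0 l.toNNReal y) (hone y)]
      rw [integral_negativePart_gaussianPDFReal hNondeg MeasurableSet.univ]
      simp
    refine ⟨fun p => gaussianPDFReal 0 l.toNNReal p.1 * gaussianPDFReal m (ρ 0).toNNReal p.2,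
      gaussianPDFReal m (ρ 0).toNNReal, ⟨?_, ?_, ?_⟩, ⟨?_, ?_, ?_⟩, ?_, ?_, ?_, ?_⟩
    · exact ((continuous_gaussianPDFReal _ _).comp continuous_fst).mul
        ((continuous_gaussianPDFReal _ _).comp continuous_snd)
    · exact fun p => mul_nonneg (gaussianPDFReal_nonneg _ _ _) (gaussianPDFReal_nonneg _ _ _)
    · have hsm : AEMeasurable (pathSlope W 0) P :=
        (hU.measurable_pathSlope 0).aemeasurable.congr hslope
      rw [(indepFun_iff_map_prod_eq_prod_map_map hsm (hGauss.aemeasurable 0)).1 hind, hlawS, hlawW,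
        gaussianReal_of_var_ne_zero _ hvl, gaussianReal_of_var_ne_zero _ hv,
        prod_withDensity (measurable_gaussianPDF _ _) (measurable_gaussianPDF _ _)]
      congr 1
      ext p
      rw [ENNReal.ofReal_mul (gaussianPDFReal_nonneg _ _ _)]
      rfl
    · exact continuous_gaussianPDFReal _ _
    · exact gaussianPDFReal_nonneg _ _
    · rw [hlawW, gaussianReal_of_var_ne_zero _ hv]
      rfl
    · exact gaussianPDFReal_pos _ _ _ hv
    · refine (integrable_negativePart_gaussianPDFReal hNondeg MeasurableSet.univ).congr
        (Filter.Eventually.of_forall fun y => ?_)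
      simp only
      rw [← hone, mul_div_cancel_right₀ _ (gaussianPDFReal_pos _ _ _ hv).ne']
    · rw [hcondtot]
      exact hs
    · intro w
      rw [mul_div_mul_right _ _ (gaussianPDFReal_pos _ _ _ hv).ne', hcondtot, hcond, hpalm,
        integral_negativePart_gaussianPDFReal hNondeg measurableSet_Iic,
        mul_div_cancel_left₀ _ hs.ne']
      rfl
  · -- the spectral moment
    intro S κ hS
    have ha : Measurable fun p : ℝ × ℝ => κ p.1 * Real.cos p.2 :=
      (hS.measurable_dispersion.comp measurable_fst).mul (Real.measurable_cos.comp measurable_snd)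
    have hdom : MeasurableSet spectralDomain := measurableSet_Ioi.prod measurableSet_Icc
    have hS0 : 0 ≤ᵐ[volume.restrict spectralDomain] S :=
      (ae_restrict_iff' hdom).2 (Filter.Eventually.of_forall hS.nonneg)
    have hρS : ∀ t, ρ t =
        ∫ p in spectralDomain, Real.cos (κ p.1 * Real.cos p.2 * t) * S p := by
      intro t
      have h := hS.covariance_eq 0 t
      rw [zero_add] at h
      rw [hρdef]
      simp only
      rw [h]
      congr 1
      ext p
      congr 2
      ring
    have hint : ∀ t, IntegrableOn (fun p => Real.cos (κ p.1 * Real.cos p.2 * t) * S p)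
        spectralDomain := by
      intro t
      refine Integrable.bdd_mul (c := 1) hS.integrable
        (Real.measurable_cos.comp (ha.mul_const t)).aestronglyMeasurable ?_
      exact Filter.Eventually.of_forall fun p => by
        rw [Real.norm_eq_abs]
        exact Real.abs_cos_le_one _
    have hlim := hU.tendsto_variance_slope 0
    rw [hl] at hlim
    -- Inserting the spectral form of `ρ 0` and `ρ t` turns `2 (ρ 0 - ρ t) / t²` into the required
    -- integral.
    have key := integrable_sq_mul_of_tendsto (L := l) ha hS.integrable hS0 (hlim.congr fun t => by
      rw [hρS 0, hρS t, ← integral_sub (hint 0) (hint t), ← integral_const_mul, ← integral_div]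
      congr 1
      ext p
      rw [mul_zero, Real.cos_zero]
      ring)
    refine ⟨key.1, ?_⟩
    rw [spectralMoment, ← key.2]
    simp only [pow_zero, mul_one]
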